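/- **Syntax.** Fix a first-order language and a countably infinite set of variables. Atoms are $\mathsf{t}$, $\mathsf{f}$, $p(t_1,\dots,t_n)$ and $\bar p(t_1,\dots,t_n)$, where $t_1,\dots,t_n$ are terms, $p$ is an $n$-ary predicate symbol and $\bar p$ is its dual; formulas are built from atoms by $\wedge,\vee,\exists x,\forall x$. Duality of atoms is $\bar{\mathsf t}=\mathsf f$, $\overline{p(\vec t)}=\bar p(\vec t)$, $\bar{\bar a}=a$. A formula is *rectified* if its bound variables are distinct from one another and from all free variables. The equivalence $\equiv$ is the congruence generated by associativity and commutativity of $\wedge$ and $\vee$, $\forall x\forall y A\equiv\forall y\forall x A$, $\exists x\exists y A\equiv\exists y\exists x A$, and, for $x$ not free in $B$, $\forall x(A\vee B)\equiv(\forall xA)\vee B$ and $\exists x(A\wedge B)\equiv(\exists xA)\wedge B$. **Derivations.** The system $\mathsf{MLS1^X}$ has the following rules (premise $\to$ conclusion), applicable inside any positive context $S\{\cdot\}$: $\mathsf t\to\forall x.\mathsf t$; $\;\mathsf t\to a\vee\bar a$ ($\mathsf{ai}$, $a$ any atom); $\;A\to A\wedge\mathsf t$; $\;A\wedge(B\vee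 C)\to(A\wedge B)\vee C$; $\;A\wedge B\to A\vee B$; $\;A[x/t]\to\exists x.A$ ($t$ free for $x$ in $A$, i.e. no capture); $\;B\to A$ if $A\equiv B$. A derivation is *rectified* if each of its lines is. Tracing atom occurrences upwards through a derivation $\Phi$ of $A$ from $\mathsf t$, two atom occurrences of $A$ are *linked* by $\Phi$ if they are introduced by the same instance of $\mathsf{ai}$. The *dualizer* $\delta_\Phi$ of $\Phi$ is the composite of the substitutions $[x/t]$ of the $\exists$-instances of $\Phi$, applied in the order from the conclusion upwards; so a variable that is not introduced by an $\exists$-instance is left fixed, and one that is introduced by such an instance goes to its term $t$ with the substitutions of the instances above it applied. **Graphs.** $G(a)$ is a single vertex labelled $a$; $G(A\vee B)$ is the disjoint union and $G(A\wedge B)$ the join of $G(A)$ and $G(B)$; $G(\forall xA)$ and $G(\exists xA)$ are the disjoint union and the join, respectively, of a single vertex labelled $x$ with $G(A)$. Vertices labelled by atoms are *literals*, those labelled by variables are *binders*. A *module* is a vertex set $M$ all of whose elements have the same neighbours outside $M$; it is *strong* if every module contains it, is contained in it, or is disjoint from it. The *scope* of a binder is the smallest strong module with at least two vertices that contains it.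 A binder is *existential* (*universal*) if it is adjacent to all (to none) of the other vertices in its scope. A *fograph* is a finite $P_4$-free graph, each vertex of which is labelled by an atom or a variable, with at least one literal, such that the scope of each $x$-binder contains a literal and no other $x$-binder. **Fonets.** A *linked fograph* is a fograph with a partial equivalence relation on its vertices each class of which (a *link*) consists of two literals with dual predicate symbols (arguments may differ, and neither is $\mathsf t$ or $\mathsf f$), such that every literal is $\mathsf t$-labelled or in a link. A *dualizer* of it is a substitution that is the identity on all variables that do not label an existential binder, and that makes the two atoms of each link dual. It is *most general* if every dualizer is obtained from it by a further substitution. A *dependency* is a pair of an existential $x$-binder and a universal $y$-binder such that the most general dualizer assigns to $x$ a term containing $y$. The *leap graph* has the same vertices, with the links and dependencies as edges. A nonempty vertex set $W$ *induces a matching* in a graph if each $w\in W$ has exactly one neighbour in $W$. A *fonet* is a linked fograph (with pairwise distinct bound variables) that has a dualizer and in which no vertex set induces a matching both in the graph and in its leap graph. **Theorem.** Let $\Phi$ be a rectified derivation in $\mathsf{MLS1^X}$ of a formula $A$ from $\mathsf t$, where $A$ does not contain $\mathsf f$. Then $G(A)$ with the linking of $\Phi$ is a fonet, and $\delta_\Phi$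 is a dualizer of it. -/

import Mathlib

universe u v

namespace FOCP

/-! ### First-order formulas in negation normal form

Terms are Mathlib's first-order terms `L.Term ℕ`, with variables the natural numbers. -/

/-- Atoms: the truth constants, and `p(t₁,…,tₙ)` (`pred true p t`) or its dual
`p̄(t₁,…,tₙ)` (`pred false p t`) for a predicate symbol `p` of arity `n`. -/
inductive Atom (L : FirstOrder.Language.{u, v}) : Type (max u v)
  | tt : Atom L
  | ff : Atom L
  | pred (pos : Bool) {n : ℕ} (p : L.Relations n) (ts : Fin n → L.Term ℕ) : Atom L

namespace Atom

variable {L : FirstOrder.Language.{u, v}}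

/-- Negation of atoms. -/
def dual : Atom L → Atom L
  | tt => ff
  | ff => tt
  | pred b p ts => pred (!b) p ts

/-- The variables occurring in an atom. -/
def vars : Atom L → Finset ℕ
  | tt => ∅
  | ff => ∅
  | pred _ _ ts => Finset.univ.biUnion fun i => (ts i).varFinset

/-- Application of a substitution to an atom. -/
def subst (σ : ℕ → L.Term ℕ) : Atom L → Atom L
  | tt => tt
  | ff => ff
  | pred b p ts => pred b p fun i => (ts i).subst σ

/-- Two atoms are pre-dual if they are not truth constants and their predicate symbols are dual
(their arguments may differ). -/
inductive PreDual : Atom L → Atom L → Prop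
  | intro (b : Bool) {n : ℕ} (p : L.Relations n) (ts us : Fin n → L.Term ℕ) :
      PreDual (pred b p ts) (pred (!b) p us)

end Atom

/-- Formulas. -/
inductive Fml (L : FirstOrder.Language.{u, v}) : Type (max u v)
  | atom (a : Atom L) : Fml L
  | and (A B : Fml L) : Fml L
  | or (A B : Fml L) : Fml L
  | ex (x : ℕ) (A : Fml L) : Fml L
  | all (x : ℕ) (A : Fml L) : Fml L

/-- The substitution `[x/t]`, the identity off `x`. -/
def single {L : FirstOrder.Language.{u, v}} (x : ℕ) (t : L.Term ℕ) : ℕ → L.Term ℕ :=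
  Function.update FirstOrder.Language.Term.var x t

namespace Fml

variable {L : FirstOrder.Language.{u, v}}

/-- The free variables of a formula. -/
def freeVars : Fml L → Finset ℕ
  | atom a => a.vars
  | and A B => A.freeVars ∪ B.freeVars
  | or A B => A.freeVars ∪ B.freeVars
  | ex x A => A.freeVars.erase x
  | all x A => A.freeVars.erase x

/-- The list of the bound variables of a formula, one entry for each quantifier occurrence. -/
def boundVars : Fml L → List ℕ
  | atom _ => []
  | and A B => A.boundVars ++ B.boundVars
  | or A B => A.boundVars ++ B.boundVars
  | ex x A => x :: A.boundVars
  | all x A => x :: A.boundVars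

/-- All bound variables are distinct from one another and from all free variables. -/
def Rectified (A : Fml L) : Prop :=
  A.boundVars.Nodup ∧ ∀ x ∈ A.boundVars, x ∉ A.freeVars

/-- The formula does not contain the truth constant `ff`. -/
def FFree : Fml L → Prop
  | atom a => a ≠ Atom.ff
  | and A B => A.FFree ∧ B.FFree
  | or A B => A.FFree ∧ B.FFree
  | ex _ A => A.FFree
  | all _ A => A.FFree

/-- Simultaneous substitution for the free occurrences of variables. -/
def subst : (ℕ → L.Term ℕ) → Fml L → Fml L
  | σ, atom a => atom (a.subst σ)
  | σ, and A B => and (A.subst σ) (B.subst σ)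
  | σ, or A B => or (A.subst σ) (B.subst σ)
  | σ, ex y A => ex y (A.subst (Function.update σ y (FirstOrder.Language.Term.var y)))
  | σ, all y A => all y (A.subst (Function.update σ y (FirstOrder.Language.Term.var y)))

/-- The term `t` is free for `x` in the formula: no free occurrence of `x` is in the scope of a
quantifier that binds a variable of `t`, so that substituting `t` for `x` captures nothing. -/
def FreeFor (x : ℕ) (t : L.Term ℕ) : Fml L → Prop
  | atom _ => True
  | and A B => A.FreeFor x t ∧ B.FreeFor x t
  | or A B => A.FreeFor x t ∧ B.FreeFor x t
  | ex y A => x ∉ (ex y A).freeVars ∨ (y ∉ t.varFinset ∧ A.FreeFor x t)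
  | all y A => x ∉ (all y A).freeVars ∨ (y ∉ t.varFinset ∧ A.FreeFor x t)

/-- The vertices of the graph of a formula, that is, the occurrences of atoms and of quantifiers
in it. -/
def Vtx : Fml L → Type
  | atom _ => Unit
  | and A B => A.Vtx ⊕ B.Vtx
  | or A B => A.Vtx ⊕ B.Vtx
  | ex _ A => Unit ⊕ A.Vtx
  | all _ A => Unit ⊕ A.Vtx

/-- Substitution does not change the occurrences of atoms and quantifiers. -/
def substVtx : (σ : ℕ → L.Term ℕ) → (A : Fml L) → A.Vtx ≃ (A.subst σ).Vtx
  | _, atom _ => Equiv.refl Unit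
  | σ, and A B => Equiv.sumCongr (substVtx σ A) (substVtx σ B)
  | σ, or A B => Equiv.sumCongr (substVtx σ A) (substVtx σ B)
  | σ, ex y A => Equiv.sumCongr (Equiv.refl Unit)
      (substVtx (Function.update σ y (FirstOrder.Language.Term.var y)) A)
  | σ, all y A => Equiv.sumCongr (Equiv.refl Unit)
      (substVtx (Function.update σ y (FirstOrder.Language.Term.var y)) A)

end Fml

/-! ### Labelled graphs and fographs -/

section Modules

variable {V : Type}

/-- A cograph is a graph without the path on four vertices as an induced subgraph. -/
def IsCograph (G : SimpleGraph V) : Prop :=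
  IsEmpty (SimpleGraph.pathGraph 4 ↪g G)

/-- Any two vertices of a module have the same neighbours outside of it. -/
def IsModule (G : SimpleGraph V) (M : Set V) : Prop :=
  ∀ v ∈ M, ∀ w ∈ M, G.neighborSet v \ M = G.neighborSet w \ M

/-- A strong module is comparable with or disjoint from every module. -/
def IsStrongModule (G : SimpleGraph V) (M : Set V) : Prop :=
  IsModule G M ∧ ∀ M' : Set V, IsModule G M' → M' ⊆ M ∨ M ⊆ M' ∨ Disjoint M M'

/-- The smallest strong module with at least two elements that contains the vertex `b`. The strong
modules containing `b` form a chain, so the smallest one is the intersection. -/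
def scope (G : SimpleGraph V) (b : V) : Set V :=
  ⋂₀ {M : Set V | IsStrongModule G M ∧ M.Nontrivial ∧ b ∈ M}

/-- The vertex set `W` induces a matching: it is nonempty, and each of its elements has exactly one
neighbour in it. -/
def InducesMatching (G : SimpleGraph V) (W : Set V) : Prop :=
  W.Nonempty ∧ ∀ w ∈ W, ∃ u, G.neighborSet w ∩ W = {u}

end Modules

/-- A vertex label is an atom or a variable. -/
inductive Label (L : FirstOrder.Language.{u, v}) : Type (max u v)
  | atom (a : Atom L) : Label L
  | var (x : ℕ) : Label L

/-- Finite undirected graphs with vertices labelled by atoms and variables. -/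
structure LabelledGraph (L : FirstOrder.Language.{u, v}) (V : Type) : Type (max u v) where
  graph : SimpleGraph V
  label : V → Label L
  finite : Finite V

namespace LabelledGraph

variable {L : FirstOrder.Language.{u, v}} {V W : Type}

/-- The graph with a single vertex, labelled `l`. -/
def single (l : Label L) : LabelledGraph L Unit where
  graph := ⊥
  label := fun _ => l
  finite := inferInstance

/-- The union `G + H` of disjoint copies. -/
def union (G : LabelledGraph L V) (H : LabelledGraph L W) : LabelledGraph L (V ⊕ W) where
  graph := G.graph ⊕g H.graph
  label := Sum.elim G.label H.label
  finite := have := G.finite; have := H.finite; inferInstance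

/-- The join `G × H` of disjoint copies. -/
def join (G : LabelledGraph L V) (H : LabelledGraph L W) : LabelledGraph L (V ⊕ W) where
  graph := (G.graph ⊕g H.graph) ⊔ completeBipartiteGraph V W
  label := Sum.elim G.label H.label
  finite := have := G.finite; have := H.finite; inferInstance

/-- Literals are the vertices labelled by an atom. -/
def IsLiteral (G : LabelledGraph L V) (v : V) : Prop := ∃ a, G.label v = Label.atom a

/-- Binders are the vertices labelled by a variable. -/
def IsBinder (G : LabelledGraph L V) (v : V) : Prop := ∃ x, G.label v = Label.var x

/-- Logical cographs: cographs with at least one literal. -/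
def IsLogicalCograph (G : LabelledGraph L V) : Prop :=
  IsCograph G.graph ∧ ∃ v, G.IsLiteral v

/-- Existential binders are adjacent to all other vertices in their scope. -/
def IsExistential (G : LabelledGraph L V) (b : V) : Prop :=
  G.IsBinder b ∧ ∀ v ∈ scope G.graph b, v ≠ b → G.graph.Adj b v

/-- Universal binders are adjacent to no other vertex in their scope. -/
def IsUniversal (G : LabelledGraph L V) (b : V) : Prop :=
  G.IsBinder b ∧ ∀ v ∈ scope G.graph b, v ≠ b → ¬ G.graph.Adj b v

/-- The scope of a legal `x`-binder contains no other `x`-binder and at least one literal. -/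
def IsLegal (G : LabelledGraph L V) (b : V) : Prop :=
  (∀ c ∈ scope G.graph b, c ≠ b → G.label c ≠ G.label b) ∧
    ∃ c ∈ scope G.graph b, G.IsLiteral c

/-- Fographs: logical cographs all of whose binders are legal. -/
def IsFograph (G : LabelledGraph L V) : Prop :=
  G.IsLogicalCograph ∧ ∀ b, G.IsBinder b → G.IsLegal b

end LabelledGraph

/-- The graph of a formula. -/
def Fml.toGraph {L : FirstOrder.Language.{u, v}} : (A : Fml L) → LabelledGraph L A.Vtx
  | .atom a => LabelledGraph.single (Label.atom a)
  | .and A B => A.toGraph.join B.toGraph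
  | .or A B => A.toGraph.union B.toGraph
  | .ex x A => (LabelledGraph.single (Label.var x)).join A.toGraph
  | .all x A => (LabelledGraph.single (Label.var x)).union A.toGraph

/-! ### Linked fographs and fonets -/

/-- Labelled graphs that carry a partial equivalence relation on the vertices. -/
structure ColouredGraph (L : FirstOrder.Language.{u, v}) (V : Type) extends
    LabelledGraph L V where
  col : V → V → Prop
  symm : ∀ v w, col v w → col w v
  trans : ∀ v w z, col v w → col w z → col v z

namespace ColouredGraph

variable {L : FirstOrder.Language.{u, v}} {V : Type}

/-- Linked fographs: fographs in which each colour class consists of two pre-dual literals, and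
each literal is labelled by `tt` or belongs to a colour class. -/
def IsLinkedFograph (C : ColouredGraph L V) : Prop :=
  C.IsFograph ∧
  (∀ v, C.col v v → ∃ w a b, v ≠ w ∧ {z | C.col v z} = {v, w} ∧
    C.label v = Label.atom a ∧ C.label w = Label.atom b ∧ Atom.PreDual a b) ∧
  ∀ v a, C.label v = Label.atom a → a = Atom.tt ∨ C.col v v

/-- A dualizer is a substitution that unifies all links (up to duality of predicate symbols).
It instantiates the variables of existential binders only: all other variables, in particular
the universally bound ones, are treated as constants. -/
def IsDualizer (C : ColouredGraph L V) (δ : ℕ → L.Term ℕ) : Prop :=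
  (∀ x, (¬ ∃ b, C.IsExistential b ∧ C.label b = Label.var x) →
    δ x = FirstOrder.Language.Term.var x) ∧
  ∀ v w a b, C.col v w → v ≠ w → C.label v = Label.atom a → C.label w = Label.atom b →
    b.subst δ = (a.subst δ).dual

/-- Most general dualizers: those of which every dualizer is an instance. -/
def IsMostGeneralDualizer (C : ColouredGraph L V) (δ : ℕ → L.Term ℕ) : Prop :=
  C.IsDualizer δ ∧
    ∀ δ', C.IsDualizer δ' → ∃ ρ : ℕ → L.Term ℕ, ∀ x, δ' x = (δ x).subst ρ

/-- The existential `x`-binder `b` depends on the universal `y`-binder `c` if the most general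
dualizer (which is unique up to renaming of existential variables) assigns to `x` a term that
contains `y`. -/
def IsDependency (C : ColouredGraph L V) (b c : V) : Prop :=
  C.IsExistential b ∧ C.IsUniversal c ∧
    ∃ x y δ, C.label b = Label.var x ∧ C.label c = Label.var y ∧
      C.IsMostGeneralDualizer δ ∧ y ∈ (δ x).varFinset

/-- The leap graph: the edges are the links and the dependencies, as unordered pairs. -/
def leapGraph (C : ColouredGraph L V) : SimpleGraph V :=
  SimpleGraph.fromRel fun v w => C.col v w ∨ C.IsDependency v w

/-- The set `W` induces a matching both in the graph and in its leap graph. -/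
def InducesBimatching (C : ColouredGraph L V) (W : Set V) : Prop :=
  InducesMatching C.graph W ∧ InducesMatching C.leapGraph W

/-- Fonets: linked fographs that have a dualizer and no induced bimatching. -/
def IsFonet (C : ColouredGraph L V) : Prop :=
  C.IsLinkedFograph ∧ (∃ δ, C.IsDualizer δ) ∧ ¬ ∃ W, C.InducesBimatching W

end ColouredGraph

/-! ### The linear deep inference system -/

section Deriv

variable {L : FirstOrder.Language.{u, v}}

/-- Equivalence of formulas. An element is a particular chain of equations, as the chain
determines which occurrence goes where. -/
inductive FEquiv : Fml L → Fml L → Type (max u v)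
  | refl (A) : FEquiv A A
  | symm {A B} : FEquiv A B → FEquiv B A
  | trans {A B C} : FEquiv A B → FEquiv B C → FEquiv A C
  | andCongr {A A' B B'} : FEquiv A A' → FEquiv B B' → FEquiv (.and A B) (.and A' B')
  | orCongr {A A' B B'} : FEquiv A A' → FEquiv B B' → FEquiv (.or A B) (.or A' B')
  | exCongr (x) {A A'} : FEquiv A A' → FEquiv (.ex x A) (.ex x A')
  | allCongr (x) {A A'} : FEquiv A A' → FEquiv (.all x A) (.all x A')
  | andComm (A B) : FEquiv (.and A B) (.and B A)
  | andAssoc (A B C) : FEquiv (.and (.and A B) C) (.and A (.and B C))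
  | orComm (A B) : FEquiv (.or A B) (.or B A)
  | orAssoc (A B C) : FEquiv (.or (.or A B) C) (.or A (.or B C))
  | allSwap (x y A) : FEquiv (.all x (.all y A)) (.all y (.all x A))
  | exSwap (x y A) : FEquiv (.ex x (.ex y A)) (.ex y (.ex x A))
  | allOr (x A B) : x ∉ B.freeVars → FEquiv (.all x (.or A B)) (.or (.all x A) B)
  | exAnd (x A B) : x ∉ B.freeVars → FEquiv (.ex x (.and A B)) (.and (.ex x A) B)

/-- Exchange of the two outermost summands. -/
def sumSwap (U W X : Type) : U ⊕ (W ⊕ X) ≃ W ⊕ (U ⊕ X) :=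
  ((Equiv.sumAssoc U W X).symm.trans (Equiv.sumCongr (Equiv.sumComm U W) (Equiv.refl X))).trans
    (Equiv.sumAssoc W U X)

/-- The bijection between occurrences that an equivalence induces. -/
def FEquiv.vtx : {A B : Fml L} → FEquiv A B → A.Vtx ≃ B.Vtx
  | _, _, refl A => Equiv.refl A.Vtx
  | _, _, symm e => e.vtx.symm
  | _, _, trans e f => e.vtx.trans f.vtx
  | _, _, andCongr e f => Equiv.sumCongr e.vtx f.vtx
  | _, _, orCongr e f => Equiv.sumCongr e.vtx f.vtx
  | _, _, exCongr _ e => Equiv.sumCongr (Equiv.refl Unit) e.vtx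
  | _, _, allCongr _ e => Equiv.sumCongr (Equiv.refl Unit) e.vtx
  | _, _, andComm A B => Equiv.sumComm A.Vtx B.Vtx
  | _, _, andAssoc A B C => Equiv.sumAssoc A.Vtx B.Vtx C.Vtx
  | _, _, orComm A B => Equiv.sumComm A.Vtx B.Vtx
  | _, _, orAssoc A B C => Equiv.sumAssoc A.Vtx B.Vtx C.Vtx
  | _, _, allSwap _ _ A => sumSwap Unit Unit A.Vtx
  | _, _, exSwap _ _ A => sumSwap Unit Unit A.Vtx
  | _, _, allOr _ A B _ => (Equiv.sumAssoc Unit A.Vtx B.Vtx).symm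
  | _, _, exAnd _ A B _ => (Equiv.sumAssoc Unit A.Vtx B.Vtx).symm

/-- Positive contexts: formulas with one hole in the position of an atom. -/
inductive Ctx (L : FirstOrder.Language.{u, v}) : Type (max u v)
  | hole : Ctx L
  | andL (S : Ctx L) (B : Fml L) : Ctx L
  | andR (A : Fml L) (S : Ctx L) : Ctx L
  | orL (S : Ctx L) (B : Fml L) : Ctx L
  | orR (A : Fml L) (S : Ctx L) : Ctx L
  | ex (x : ℕ) (S : Ctx L) : Ctx L
  | all (x : ℕ) (S : Ctx L) : Ctx L

/-- Replacement of the hole by a formula (which may be captured by the context). -/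
def Ctx.fill : Ctx L → Fml L → Fml L
  | hole, F => F
  | andL S B, F => .and (S.fill F) B
  | andR A S, F => .and A (S.fill F)
  | orL S B, F => .or (S.fill F) B
  | orR A S, F => .or A (S.fill F)
  | ex x S, F => .ex x (S.fill F)
  | all x S, F => .all x (S.fill F)

/-- Extension of a partial map between the occurrences in `Q` and those in `P` by the identity on
the occurrences in a context. -/
def Ctx.extend {P Q : Fml L} (f : Q.Vtx → Option P.Vtx) :
    (S : Ctx L) → (S.fill Q).Vtx → Option (S.fill P).Vtx
  | hole => f
  | andL S _ => Sum.elim (fun o => (S.extend f o).map Sum.inl) (fun o => some (Sum.inr o))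
  | andR _ S => Sum.elim (fun o => some (Sum.inl o)) (fun o => (S.extend f o).map Sum.inr)
  | orL S _ => Sum.elim (fun o => (S.extend f o).map Sum.inl) (fun o => some (Sum.inr o))
  | orR _ S => Sum.elim (fun o => some (Sum.inl o)) (fun o => (S.extend f o).map Sum.inr)
  | ex _ S => Sum.elim (fun o => some (Sum.inl o)) (fun o => (S.extend f o).map Sum.inr)
  | all _ S => Sum.elim (fun o => some (Sum.inl o)) (fun o => (S.extend f o).map Sum.inr)

/-- The inference rules of the linear fragment, without their context; `Rule P Q` has premise `P`
and conclusion `Q`. -/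
inductive Rule : Fml L → Fml L → Type (max u v)
  | all (x : ℕ) : Rule (.atom .tt) (.all x (.atom .tt))
  | ai (a : Atom L) : Rule (.atom .tt) (.or (.atom a) (.atom a.dual))
  | tt (A : Fml L) : Rule A (.and A (.atom .tt))
  | sw (A B C : Fml L) : Rule (.and A (.or B C)) (.or (.and A B) C)
  | mix (A B : Fml L) : Rule (.and A B) (.or A B)
  | ex (x : ℕ) (t : L.Term ℕ) (A : Fml L) (h : A.FreeFor x t) :
      Rule (A.subst (single x t)) (.ex x A)
  | equiv {A B : Fml L} (e : FEquiv A B) : Rule B A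

/-- The occurrence in the premise that corresponds to an occurrence in the conclusion; it is `none`
for the occurrences that the rule creates: the binder of a quantifier rule, the two atoms
of the rule `ai`, and the new truth constant of the rule `tt`. -/
def Rule.trace : {P Q : Fml L} → Rule P Q → Q.Vtx → Option P.Vtx
  | _, _, all _ => Sum.elim (fun _ => none) some
  | _, _, ai _ => fun _ => none
  | _, _, tt _ => Sum.elim some (fun _ => none)
  | _, _, sw A B C => fun o => some (Equiv.sumAssoc A.Vtx B.Vtx C.Vtx o)
  | _, _, mix _ _ => some
  | _, _, ex x t A _ => Sum.elim (fun _ => none) (fun o => some (A.substVtx (single x t) o))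
  | _, _, equiv e => fun o => some (e.vtx o)

/-- Whether a rule is the rule `ai`. -/
def Rule.isAi : {P Q : Fml L} → Rule P Q → Bool
  | _, _, ai _ => true
  | _, _, _ => false

/-- Derivations from the formula `B` to a formula, as lists of rule instances in contexts. -/
inductive Derivation (B : Fml L) : Fml L → Type (max u v)
  | nil : Derivation B B
  | step (S : Ctx L) {P Q : Fml L} (r : Rule P Q) (Φ : Derivation B (S.fill P)) :
      Derivation B (S.fill Q)

namespace Derivation

variable {B : Fml L}

/-- The number of rule instances. -/
def length : {A : Fml L} → Derivation B A → ℕ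
  | _, nil => 0
  | _, step _ _ Φ => Φ.length + 1

/-- Every line of the derivation is rectified. -/
def Rectified : {A : Fml L} → Derivation B A → Prop
  | _, nil => B.Rectified
  | _, step S (Q := Q) _ Φ => (S.fill Q).Rectified ∧ Φ.Rectified

/-- The instance of the rule `ai` (given by its position, counted from the premise) that an
occurrence in the conclusion originates from, if there is one. -/
def aiInstance : {A : Fml L} → Derivation B A → A.Vtx → Option ℕ
  | _, nil => fun _ => none
  | _, step S r Φ => fun o =>
      match S.extend r.trace o with
      | some o' => Φ.aiInstance o'
      | none => if r.isAi then some Φ.length else none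

/-- The substitution determined by a derivation: the composite of the substitutions `[x/t]` of the
instances of the existential rule, taken from the conclusion of the derivation upwards. -/
def dualizer : {A : Fml L} → Derivation B A → ℕ → L.Term ℕ
  | _, nil => FirstOrder.Language.Term.var
  | _, step _ (Rule.ex x t _ _) Φ => fun z => (single x t z).subst Φ.dualizer
  | _, step _ _ Φ => Φ.dualizer

/-- The graph of the conclusion, coloured by the linking of the derivation: two atom occurrences
are linked if they are consumed by the same instance of the rule `ai`. -/
def linkedGraph {A : Fml L} (Φ : Derivation B A) : ColouredGraph L A.Vtx where
  toLabelledGraph := A.toGraph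
  col v w := ∃ k, Φ.aiInstance v = some k ∧ Φ.aiInstance w = some k
  symm := fun _ _ ⟨k, h, h'⟩ => ⟨k, h', h⟩
  trans := fun _ _ _ ⟨k, h, h'⟩ ⟨_, g, g'⟩ => ⟨k, h, g'.trans (g.symm.trans h')⟩

end Derivation

end Deriv

end FOCP

/-! The core is the absence of bimatchings. It is proved with valuations in the three-element
Sugihara monoid `{-1, 0, 1}`: all occurrences, binders included, carry values, `∧` and `∃` act as
`tens`, and `∨` and `∀` act as `par`.

Suppose that `W` induces a matching in the graph and in the leap graph. The union of two perfect
matchings is bipartite (`exists_alternating_colouring`), so `W` can be given signs `±1` that are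
opposite along the edges of both matchings; outside of `W` the value is `0`. The matching in the
graph forces the value of the formula to be `-1` (`Fml.isNegative_val`). The matching in the leap
graph joins each `-1` to a `1` by a link or a dependency. Soundness, by induction on the derivation,
shows that all valuations explained in this way give a nonnegative value, which is a contradiction.

For most rules soundness is an inequality of the monoid between premise and conclusion
(`Rule.val_le`, `IsSound.step`). The existential rule is the hard case: its new binder interacts
with the binders above it, and the valuation has to be corrected there before it is passed on to the
premise (`IsSound.step_ex`).

The induction does not use the dependencies themselves, which are not stable under rules, but a
larger relation built along the derivation (`IsDepRel`). To see that it is larger, it suffices to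
find for each universal variable `y` one dualizer whose values contain `y` only where the relation
allows it: every dualizer is an instance of the most general one, and instantiation cannot remove
the constant `y` (`IsDepRel.of_isDependency`). The dualizer may vary with `y`.

For the other claims, occurrences are traced through the derivation: links are pairs of dual atoms
(`exists_link`), and the composite substitution dualizes them (`dualizes_dualizer`). In the graph of
a formula, scopes are bounded from below by hulls and from above by dominated modules, which
identifies the existential binders with the existential quantifiers (`Fml.isExistential_iff`). -/

namespace FOCP

open FirstOrder.Language (Term)

/-! ### Substitutions -/

section Substitution

variable {L : FirstOrder.Language.{u, v}}

theorem term_subst_var (t : L.Term ℕ) : t.subst Term.var = t := by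
  induction t with
  | var => rfl
  | func f ts ih => simp only [Term.subst, ih]

theorem term_subst_subst (t : L.Term ℕ) (σ τ : ℕ → L.Term ℕ) :
    (t.subst σ).subst τ = t.subst fun z => (σ z).subst τ := by
  induction t with
  | var => rfl
  | func f ts ih => simp only [Term.subst, ih]

theorem term_subst_congr {t : L.Term ℕ} {σ τ : ℕ → L.Term ℕ}
    (h : ∀ z ∈ t.varFinset, σ z = τ z) : t.subst σ = t.subst τ := by
  induction t with
  | var z => exact h z (by simp [Term.varFinset])
  | func f ts ih =>
    simp only [Term.subst]
    congr 1
    funext i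
    exact ih i fun z hz => h z
      (by simp only [Term.varFinset, Finset.mem_biUnion]; exact ⟨i, by simp, hz⟩)

theorem mem_varFinset_subst {t : L.Term ℕ} {σ : ℕ → L.Term ℕ} {y : ℕ} :
    y ∈ (t.subst σ).varFinset ↔ ∃ z ∈ t.varFinset, y ∈ (σ z).varFinset := by
  induction t with
  | var z => simp [Term.varFinset, Term.subst]
  | func f ts ih =>
    simp only [Term.subst, Term.varFinset, Finset.mem_biUnion, ih]
    aesop

theorem single_self (x : ℕ) (t : L.Term ℕ) : single x t x = t := by simp [single]

theorem single_of_ne {x z : ℕ} (t : L.Term ℕ) (h : z ≠ x) : single x t z = Term.var z := by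
  simp [single, h]

theorem update_single_of_ne {x y : ℕ} (t : L.Term ℕ) (h : y ≠ x) :
    Function.update (single x t) y (Term.var y) = single x t := by
  rw [Function.update_eq_self_iff, single_of_ne t h]

namespace Atom

theorem subst_var (a : Atom L) : a.subst Term.var = a := by
  cases a <;> simp [subst, term_subst_var]

theorem subst_subst (a : Atom L) (σ τ : ℕ → L.Term ℕ) :
    (a.subst σ).subst τ = a.subst fun z => (σ z).subst τ := by
  cases a <;> simp [subst, term_subst_subst]

theorem subst_congr {a : Atom L} {σ τ : ℕ → L.Term ℕ} (h : ∀ z ∈ a.vars, σ z = τ z) :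
    a.subst σ = a.subst τ := by
  cases a with
  | tt => rfl
  | ff => rfl
  | pred b p ts =>
    simp only [subst]
    congr 1
    funext i
    refine term_subst_congr fun z hz => h z ?_
    simp only [vars, Finset.mem_biUnion]
    exact ⟨i, by simp, hz⟩

theorem subst_single_of_notMem {a : Atom L} {x : ℕ} (t : L.Term ℕ) (h : x ∉ a.vars) :
    a.subst (single x t) = a := by
  conv_rhs => rw [← a.subst_var]
  exact subst_congr fun z hz => single_of_ne t (by rintro rfl; exact h hz)

theorem mem_vars_subst {a : Atom L} {σ : ℕ → L.Term ℕ} {y : ℕ} :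
    y ∈ (a.subst σ).vars ↔ ∃ z ∈ a.vars, y ∈ (σ z).varFinset := by
  cases a with
  | tt => simp [subst, vars]
  | ff => simp [subst, vars]
  | pred b p ts =>
    simp only [subst, vars, Finset.mem_biUnion, mem_varFinset_subst]
    aesop

theorem dual_subst (a : Atom L) (σ : ℕ → L.Term ℕ) : a.dual.subst σ = (a.subst σ).dual := by
  cases a <;> rfl

theorem dual_dual (a : Atom L) : a.dual.dual = a := by
  cases a <;> simp [dual]

theorem subst_eq_tt {a : Atom L} {σ : ℕ → L.Term ℕ} : a.subst σ = tt ↔ a = tt := by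
  cases a <;> simp [subst]

theorem subst_eq_ff {a : Atom L} {σ : ℕ → L.Term ℕ} : a.subst σ = ff ↔ a = ff := by
  cases a <;> simp [subst]

theorem preDual_of_subst {a b : Atom L} {σ : ℕ → L.Term ℕ} (h : b.subst σ = (a.subst σ).dual)
    (ha : a ≠ ff) (hb : b ≠ ff) : PreDual a b := by
  cases a with
  | tt => exact absurd (subst_eq_ff.1 h) hb
  | ff => exact absurd rfl ha
  | pred c p ts =>
    cases b with
    | tt => simp [subst, dual] at h
    | ff => exact absurd rfl hb
    | pred d q us =>
      simp only [subst, dual, pred.injEq] at h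
      obtain ⟨rfl, rfl, h, -⟩ := h
      cases eq_of_heq h
      exact PreDual.intro c _ ts us

end Atom

end Substitution

/-! ### The three-element Sugihara monoid -/

/-- The multiplication of the three-element Sugihara monoid. -/
def tens (a b : SignType) : SignType := if a = -1 ∨ b = -1 then -1 else max a b

/-- The dual of the multiplication of the three-element Sugihara monoid. -/
def par (a b : SignType) : SignType := if a = 1 ∨ b = 1 then 1 else min a b

theorem tens_comm : ∀ a b, tens a b = tens b a := by decide
theorem par_comm : ∀ a b, par a b = par b a := by decide
theorem tens_assoc : ∀ a b c, tens (tens a b) c = tens a (tens b c) := by decide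
theorem par_assoc : ∀ a b c, par (par a b) c = par a (par b c) := by decide
theorem tens_mono : ∀ a b c d, a ≤ b → c ≤ d → tens a c ≤ tens b d := by decide
theorem par_mono : ∀ a b c d, a ≤ b → c ≤ d → par a c ≤ par b d := by decide
theorem tens_par_le : ∀ a b c, tens a (par b c) ≤ par (tens a b) c := by decide
theorem tens_le_par : ∀ a b, tens a b ≤ par a b := by decide
theorem tens_zero : ∀ a, tens a 0 = a := by decide
theorem zero_tens : ∀ a, tens 0 a = a := by decide
theorem par_zero : ∀ a, par a 0 = a := by decide
theorem zero_par : ∀ a, par 0 a = a := by decide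
theorem tens_ne_zero_left : ∀ a b, a ≠ 0 → tens a b ≠ 0 := by decide
theorem tens_ne_zero_right : ∀ a b, b ≠ 0 → tens a b ≠ 0 := by decide
theorem par_ne_zero_left : ∀ a b, a ≠ 0 → par a b ≠ 0 := by decide
theorem par_ne_zero_right : ∀ a b, b ≠ 0 → par a b ≠ 0 := by decide

/-! ### Two perfect matchings can be coloured alternatingly -/

/-- Put `H = f ∘ g`. As `f` conjugates `H` to its inverse, it permutes the cycles of `H`, and it
maps no cycle to itself. So the cycles come in pairs exchanged by `f`, and also by `g`, because `g
x` lies in the cycle of `f x`. The colouring selects one cycle of each pair. -/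
theorem exists_alternating_colouring {X : Type*} (f g : X → X) (hf : ∀ x, f (f x) = x)
    (hg : ∀ x, g (g x) = x) (hf' : ∀ x, f x ≠ x) (hg' : ∀ x, g x ≠ x) :
    ∃ c : X → Prop, ∀ x, (c (f x) ↔ ¬ c x) ∧ (c (g x) ↔ ¬ c x) := by
  let F : Equiv.Perm X := ⟨f, f, hf, hf⟩
  let G : Equiv.Perm X := ⟨g, g, hg, hg⟩
  have hFF : F * F = 1 := by ext x; exact hf x
  have hGG : G * G = 1 := by ext x; exact hg x
  let H : Equiv.Perm X := F * G
  have hFinv : F⁻¹ = F := inv_eq_of_mul_eq_one_left hFF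
  have hGinv : G⁻¹ = G := inv_eq_of_mul_eq_one_left hGG
  have hconj : F * H * F⁻¹ = H⁻¹ := by
    simp only [H, mul_inv_rev, hFinv, hGinv]
    rw [← mul_assoc, hFF, one_mul]
  have hconjz (k : ℤ) : F * H ^ k = H ^ (-k) * F := by
    have h1 : F * H ^ k * F⁻¹ = (H⁻¹) ^ k := by rw [← hconj, conj_zpow]
    rw [zpow_neg, ← inv_zpow, ← h1]
    simp
  have hFH (k : ℤ) (x : X) : F ((H ^ k) x) = (H ^ (-k)) (F x) :=
    DFunLike.congr_fun (hconjz k) x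
  have hnot (k : ℤ) (x : X) : F x ≠ (H ^ k) x := by
    intro hx
    -- The point halfway between `x` and `F x` on the cycle is fixed by `F` if `k` is even and by
    -- `G` if `k` is odd.
    rcases Int.even_or_odd' k with ⟨m, rfl | rfl⟩
    · apply hf' ((H ^ m) x)
      change F ((H ^ m) x) = (H ^ m) x
      rw [hFH, hx, ← Equiv.Perm.mul_apply, ← zpow_add]
      congr 2
      ring
    · apply hg' ((H ^ m) x)
      have h1 : F ((H ^ m) x) = H ((H ^ m) x) := by
        rw [hFH, hx, ← Equiv.Perm.mul_apply, ← zpow_add, ← Equiv.Perm.mul_apply, ← zpow_one_add]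
        congr 2
        ring
      exact (F.injective h1).symm
  let s : Setoid X := Equiv.Perm.SameCycle.setoid H
  let q : X → Quotient s := Quotient.mk s
  have hq (x y : X) : q x = q y ↔ H.SameCycle x y := Quotient.eq
  have hqf (x : X) : q (f x) ≠ q x := by
    intro h
    obtain ⟨k, hk⟩ := ((hq _ _).1 h).symm
    exact hnot k x hk.symm
  have hfg (x : X) : q (f (g x)) = q x := (hq _ _).2 ((Equiv.Perm.SameCycle.refl H x).apply_left)
  have hgq (x : X) : q (g x) = q (f x) := by
    have h := hfg (g x)
    rw [hg] at h
    exact h.symm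
  classical
  -- An arbitrary linear order serves to select one cycle of each pair.
  let : LinearOrder (Quotient s) := linearOrderOfSTO WellOrderingRel
  refine ⟨fun x => q x < q (f x), fun x => ⟨?_, ?_⟩⟩
  · change q (f x) < q (f (f x)) ↔ _
    rw [hf, not_lt]
    exact ⟨le_of_lt, fun h => lt_of_le_of_ne h (hqf x)⟩
  · change q (g x) < q (f (g x)) ↔ _
    rw [hfg, hgq, not_lt]
    exact ⟨le_of_lt, fun h => lt_of_le_of_ne h (hqf x)⟩

/-! ### Modules -/

section Modules

variable {V W : Type}

theorem isModule_iff {G : SimpleGraph V} {M : Set V} :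
    IsModule G M ↔ ∀ v ∈ M, ∀ w ∈ M, ∀ u ∉ M, G.Adj v u → G.Adj w u := by
  constructor
  · intro h v hv w hw u hu hvu
    have : u ∈ G.neighborSet v \ M := ⟨hvu, hu⟩
    rw [h v hv w hw] at this
    exact this.1
  · intro h v hv w hw
    ext u
    exact ⟨fun ⟨h1, h2⟩ => ⟨h v hv w hw u h2 h1, h2⟩, fun ⟨h1, h2⟩ => ⟨h w hw v hv u h2 h1, h2⟩⟩

theorem isModule_univ (G : SimpleGraph V) : IsModule G Set.univ :=
  isModule_iff.2 fun _ _ _ _ _ hu => absurd trivial hu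

/-- A map that embeds the graph `G` in the graph `K` as a module. -/
structure IsModuleEmbedding (G : SimpleGraph V) (K : SimpleGraph W) (φ : V → W) : Prop where
  inj : Function.Injective φ
  adj : ∀ a b, K.Adj (φ a) (φ b) ↔ G.Adj a b
  outside : ∀ a b u, (∀ c, φ c ≠ u) → K.Adj (φ a) u → K.Adj (φ b) u

theorem IsModuleEmbedding.isModule_image {G : SimpleGraph V} {K : SimpleGraph W} {φ : V → W}
    (h : IsModuleEmbedding G K φ) {M : Set V} (hM : IsModule G M) : IsModule K (φ '' M) := by
  rw [isModule_iff] at hM ⊢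
  rintro _ ⟨v, hv, rfl⟩ _ ⟨w, hw, rfl⟩ u hu huv
  by_cases hc : ∃ c, φ c = u
  · obtain ⟨c, rfl⟩ := hc
    rw [h.adj] at huv ⊢
    exact hM v hv w hw c (fun hc => hu ⟨c, hc, rfl⟩) huv
  · push Not at hc
    exact h.outside v w u hc huv

/-- A set of vertices that surrounds `b`, is a module and remains one without `b`, and contains
another vertex. -/
structure IsHull (G : SimpleGraph V) (b : V) (N : Set V) : Prop where
  mem : b ∈ N
  isModule : IsModule G N
  isModule_diff : IsModule G (N \ {b})
  nonempty_diff : (N \ {b}).Nonempty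

theorem IsHull.image {G : SimpleGraph V} {K : SimpleGraph W} {φ : V → W}
    (h : IsModuleEmbedding G K φ) {b : V} {N : Set V} (hN : IsHull G b N) :
    IsHull K (φ b) (φ '' N) := by
  have e : φ '' N \ {φ b} = φ '' (N \ {b}) := by
    rw [Set.image_sdiff h.inj, Set.image_singleton]
  refine ⟨⟨b, hN.mem, rfl⟩, h.isModule_image hN.isModule, ?_, ?_⟩ <;> rw [e]
  · exact h.isModule_image hN.isModule_diff
  · exact hN.nonempty_diff.image φ

/-- A strong module `M` around `b` is comparable with or disjoint from `N \ {b}`. If they were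
disjoint, `M` would meet `N` in `b` alone, and since both sets have further elements, `M` and `N`
would overlap properly. -/
theorem IsHull.subset_scope {G : SimpleGraph V} {b : V} {N : Set V} (hN : IsHull G b N) :
    N ⊆ scope G b := by
  apply Set.subset_sInter
  rintro M ⟨⟨-, hs⟩, hnt, hb⟩
  have key : N \ {b} ⊆ M := by
    rcases hs _ hN.isModule_diff with h | h | h
    · exact h
    · exact absurd rfl (h hb).2
    · exfalso
      have hMN : ∀ z ∈ M, z ∈ N → z = b := fun z hz hzN => by
        by_contra hzb
        exact h.le_bot ⟨hz, hzN, hzb⟩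
      rcases hs _ hN.isModule with h' | h' | h'
      · obtain ⟨z, hzN, hzb⟩ := hN.nonempty_diff
        exact hzb (hMN z (h' hzN) hzN)
      · obtain ⟨z, hz, w, hw, hzw⟩ := hnt
        exact hzw ((hMN z hz (h' hz)).trans (hMN w hw (h' hw)).symm)
      · exact h'.le_bot ⟨hb, hN.mem⟩
  intro z hz
  by_cases hzb : z = b
  · exact hzb ▸ hb
  · exact key ⟨hz, hzb⟩

/-- The vertex `b` dominates `P`, a module that is a union of components of a larger module `N`. -/
structure IsDominated (G : SimpleGraph V) (b : V) (P N : Set V) : Prop where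
  mem : b ∈ P
  nontrivial : P.Nontrivial
  adj : ∀ v ∈ P, v ≠ b → G.Adj b v
  subset : P ⊆ N
  isModule : IsModule G P
  isModule_super : IsModule G N
  nonempty_diff : (N \ P).Nonempty
  not_adj : ∀ v ∈ P, ∀ w ∈ N, w ∉ P → ¬ G.Adj v w

theorem IsDominated.image {G : SimpleGraph V} {K : SimpleGraph W} {φ : V → W}
    (h : IsModuleEmbedding G K φ) {b : V} {P N : Set V} (hP : IsDominated G b P N) :
    IsDominated K (φ b) (φ '' P) (φ '' N) where
  mem := ⟨b, hP.mem, rfl⟩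
  nontrivial := hP.nontrivial.image h.inj
  adj := by
    rintro _ ⟨v, hv, rfl⟩ hvb
    exact (h.adj _ _).2 (hP.adj v hv fun e => hvb (e ▸ rfl))
  subset := Set.image_mono hP.subset
  isModule := h.isModule_image hP.isModule
  isModule_super := h.isModule_image hP.isModule_super
  nonempty_diff := by
    rw [← Set.image_sdiff h.inj]
    exact hP.nonempty_diff.image φ
  not_adj := by
    rintro _ ⟨v, hv, rfl⟩ _ ⟨w, hw, rfl⟩ hwP hvw
    exact hP.not_adj v hv w hw (fun hw' => hwP ⟨w, hw', rfl⟩) ((h.adj _ _).1 hvw)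

/-- Suppose that a module `M` overlaps `P` properly, with `q ∈ M \ P`. An edge of `P` that leaves
`M` makes `q` adjacent to a vertex of `P`, so `q` lies outside `N` and is adjacent to all of `N`. A
vertex of `N \ P` then becomes adjacent to one of `P`, whether or not it belongs to `M`. -/
theorem IsDominated.isStrongModule {G : SimpleGraph V} {b : V} {P N : Set V}
    (h : IsDominated G b P N) : IsStrongModule G P := by
  refine ⟨h.isModule, fun M hM => ?_⟩
  by_contra! hcon
  obtain ⟨h1, h2, h3⟩ := hcon
  obtain ⟨q, hqM, hqP⟩ := Set.not_subset.1 h1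
  -- Such an edge can be chosen at `b`, which is adjacent to all the rest of `P`.
  obtain ⟨p, r, hpM, hpP, hrP, hrM, hpr⟩ :
      ∃ p r, p ∈ M ∧ p ∈ P ∧ r ∈ P ∧ r ∉ M ∧ G.Adj p r := by
    by_cases hb : b ∈ M
    · obtain ⟨r, hrP, hrM⟩ := Set.not_subset.1 h2
      exact ⟨b, r, hb, h.mem, hrP, hrM, h.adj r hrP fun e => hrM (e ▸ hb)⟩
    · obtain ⟨p, hpP, hpM⟩ := Set.not_disjoint_iff.1 h3
      exact ⟨p, b, hpM, hpP, h.mem, hb, (h.adj p hpP fun e => hb (e ▸ hpM)).symm⟩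
  have hM' := isModule_iff.1 hM
  have hqr : G.Adj q r := hM' p hpM q hqM r hrM hpr
  have hqN : q ∉ N := fun hq => h.not_adj r hrP q hq hqP hqr.symm
  obtain ⟨d, hdN, hdP⟩ := h.nonempty_diff
  have hdq : G.Adj d q :=
    isModule_iff.1 h.isModule_super r (h.subset hrP) d hdN q hqN hqr.symm
  by_cases hdM : d ∈ M
  · exact h.not_adj r hrP d hdN hdP (hM' p hpM d hdM r hrM hpr).symm
  · exact h.not_adj p hpP d hdN hdP (hM' q hqM p hpM d hdM hdq.symm)

theorem IsDominated.scope_subset {G : SimpleGraph V} {b : V} {P N : Set V}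
    (h : IsDominated G b P N) : scope G b ⊆ P :=
  Set.sInter_subset_of_mem ⟨h.isStrongModule, h.nontrivial, h.mem⟩

/-- A graph on a disjoint union that is `G` on the first and `H` on the second summand, and in
which either all or none of the pairs of vertices from different summands are adjacent. -/
structure IsSumGraph (K : SimpleGraph (V ⊕ W)) (G : SimpleGraph V) (H : SimpleGraph W)
    (c : Prop) : Prop where
  inl : ∀ a b, K.Adj (.inl a) (.inl b) ↔ G.Adj a b
  inr : ∀ a b, K.Adj (.inr a) (.inr b) ↔ H.Adj a b
  inl_inr : ∀ a b, K.Adj (.inl a) (.inr b) ↔ c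

namespace IsSumGraph

variable {K : SimpleGraph (V ⊕ W)} {G : SimpleGraph V} {H : SimpleGraph W} {c : Prop}

theorem inr_inl (h : IsSumGraph K G H c) (a : W) (b : V) : K.Adj (.inr a) (.inl b) ↔ c := by
  rw [K.adj_comm, h.inl_inr]

theorem embedding_inl (h : IsSumGraph K G H c) : IsModuleEmbedding G K Sum.inl where
  inj := Sum.inl_injective
  adj := h.inl
  outside a b u hu := by
    rcases u with u | u
    · exact absurd rfl (hu u)
    · rw [h.inl_inr, h.inl_inr]; exact id

theorem embedding_inr (h : IsSumGraph K G H c) : IsModuleEmbedding H K Sum.inr where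
  inj := Sum.inr_injective
  adj := h.inr
  outside a b u hu := by
    rcases u with u | u
    · rw [h.inr_inl, h.inr_inl]; exact id
    · exact absurd rfl (hu u)

end IsSumGraph

theorem isCograph_iff {G : SimpleGraph V} : IsCograph G ↔
    ∀ a b c d, G.Adj a b → G.Adj b c → G.Adj c d → ¬ G.Adj a c → ¬ G.Adj a d → ¬ G.Adj b d →
      False := by
  constructor
  · intro h a b c d hab hbc hcd hac had hbd
    have hne : a ≠ c ∧ a ≠ d ∧ b ≠ d :=
      ⟨fun e => had (e ▸ hcd), fun e => hac (e ▸ hcd.symm), fun e => had (e ▸ hab)⟩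
    refine h.false ⟨⟨![a, b, c, d], ?_⟩, ?_⟩
    · intro i j
      fin_cases i <;> fin_cases j <;>
        simp [hab.ne, hab.ne.symm, hbc.ne, hbc.ne.symm, hcd.ne, hcd.ne.symm, hne.1, hne.1.symm,
          hne.2.1, hne.2.1.symm, hne.2.2, hne.2.2.symm]
    · intro i j
      change G.Adj (![a, b, c, d] i) (![a, b, c, d] j) ↔ _
      fin_cases i <;> fin_cases j <;>
        simp [SimpleGraph.pathGraph_adj, hab, hab.symm, hbc, hbc.symm, hcd, hcd.symm, hac, had, hbd,
          G.adj_comm c a, G.adj_comm d a, G.adj_comm d b]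
  · intro h
    refine ⟨fun f => ?_⟩
    have hf (i j : Fin 4) : G.Adj (f i) (f j) ↔ i.val + 1 = j.val ∨ j.val + 1 = i.val := by
      rw [f.map_adj_iff, SimpleGraph.pathGraph_adj]
    refine h (f 0) (f 1) (f 2) (f 3) ?_ ?_ ?_ ?_ ?_ ?_ <;> rw [hf] <;> decide

/-- The path on four vertices and its complement are both connected, so an induced one cannot meet
both summands. -/
theorem IsSumGraph.isCograph {K : SimpleGraph (V ⊕ W)} {G : SimpleGraph V} {H : SimpleGraph W}
    {c : Prop} (h : IsSumGraph K G H c) (hG : IsCograph G) (hH : IsCograph H) : IsCograph K := by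
  rw [isCograph_iff] at *
  intro a b d e
  rcases a with a | a <;> rcases b with b | b <;> rcases d with d | d <;> rcases e with e | e <;>
    simp only [h.inl, h.inr, h.inl_inr, h.inr_inl]
  · exact hG a b d e
  all_goals first | exact hH a b d e | tauto

end Modules

/-- The kinds of vertices of the graph of a formula. -/
inductive Kind
  | lit
  | ex
  | all

/-! ### Kinds, labels and values of the occurrences in a formula -/

namespace Fml

variable {L : FirstOrder.Language.{u, v}}

/-- The kind of an occurrence: an atom, an existential or a universal quantifier. -/
def kind : (A : Fml L) → A.Vtx → Kind
  | atom _ => fun _ => .lit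
  | and A B => Sum.elim A.kind B.kind
  | or A B => Sum.elim A.kind B.kind
  | ex _ A => Sum.elim (fun _ => .ex) A.kind
  | all _ A => Sum.elim (fun _ => .all) A.kind

/-- The label of an occurrence. -/
def lab : (A : Fml L) → A.Vtx → Label L
  | atom a => fun _ => .atom a
  | and A B => Sum.elim A.lab B.lab
  | or A B => Sum.elim A.lab B.lab
  | ex x A => Sum.elim (fun _ => .var x) A.lab
  | all x A => Sum.elim (fun _ => .var x) A.lab

/-- The value of a formula in the three-element Sugihara monoid, where quantifiers are treated as
binary connectives. -/
def val : (A : Fml L) → (A.Vtx → SignType) → SignType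
  | atom _, w => w ()
  | and A B, w => tens (A.val fun v => w (.inl v)) (B.val fun v => w (.inr v))
  | or A B, w => par (A.val fun v => w (.inl v)) (B.val fun v => w (.inr v))
  | ex _ A, w => tens (w (.inl ())) (A.val fun v => w (.inr v))
  | all _ A, w => par (w (.inl ())) (A.val fun v => w (.inr v))

theorem toGraph_label (A : Fml L) (v : A.Vtx) : A.toGraph.label v = A.lab v := by
  induction A with
  | atom a => rfl
  | and A B ihA ihB => rcases v with v | v; exacts [ihA v, ihB v]
  | or A B ihA ihB => rcases v with v | v; exacts [ihA v, ihB v]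
  | ex x A ih => rcases v with v | v; exacts [rfl, ih v]
  | all x A ih => rcases v with v | v; exacts [rfl, ih v]

theorem isSumGraph_join {V W : Type} (G : LabelledGraph L V) (H : LabelledGraph L W) :
    IsSumGraph (G.join H).graph G.graph H.graph True := by
  constructor <;> intros <;> simp [LabelledGraph.join]

theorem isSumGraph_union {V W : Type} (G : LabelledGraph L V) (H : LabelledGraph L W) :
    IsSumGraph (G.union H).graph G.graph H.graph False := by
  constructor <;> intros <;> simp [LabelledGraph.union]

theorem lab_of_kind_eq_lit {A : Fml L} {v : A.Vtx} (h : A.kind v = .lit) :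
    ∃ a, A.lab v = .atom a := by
  induction A with
  | atom a => exact ⟨a, rfl⟩
  | and A B ihA ihB => rcases v with v | v; exacts [ihA h, ihB h]
  | or A B ihA ihB => rcases v with v | v; exacts [ihA h, ihB h]
  | ex x A ih => rcases v with v | v; exacts [(nomatch h), ih h]
  | all x A ih => rcases v with v | v; exacts [(nomatch h), ih h]

theorem lab_of_kind_ne_lit {A : Fml L} {v : A.Vtx} (h : A.kind v ≠ .lit) :
    ∃ x, A.lab v = .var x := by
  induction A with
  | atom a => exact absurd rfl h
  | and A B ihA ihB => rcases v with v | v; exacts [ihA h, ihB h]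
  | or A B ihA ihB => rcases v with v | v; exacts [ihA h, ihB h]
  | ex x A ih => rcases v with v | v; exacts [⟨x, rfl⟩, ih h]
  | all x A ih => rcases v with v | v; exacts [⟨x, rfl⟩, ih h]

theorem kind_ne_lit_of_lab {A : Fml L} {v : A.Vtx} {x : ℕ} (h : A.lab v = .var x) :
    A.kind v ≠ .lit := by
  intro h'
  obtain ⟨a, ha⟩ := lab_of_kind_eq_lit h'
  simp [h] at ha

theorem exists_kind_eq_lit (A : Fml L) : ∃ v, A.kind v = .lit := by
  induction A with
  | atom a => exact ⟨(), rfl⟩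
  | and A B ihA _ => exact ihA.imp' Sum.inl fun _ h => h
  | or A B ihA _ => exact ihA.imp' Sum.inl fun _ h => h
  | ex x A ih => exact ih.imp' Sum.inr fun _ h => h
  | all x A ih => exact ih.imp' Sum.inr fun _ h => h

theorem mem_boundVars_of_lab {A : Fml L} {v : A.Vtx} {x : ℕ} (h : A.lab v = .var x) :
    x ∈ A.boundVars := by
  induction A with
  | atom a => exact nomatch h
  | and A B ihA ihB =>
    rcases v with v | v
    exacts [List.mem_append_left _ (ihA h), List.mem_append_right _ (ihB h)]
  | or A B ihA ihB =>
    rcases v with v | v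
    exacts [List.mem_append_left _ (ihA h), List.mem_append_right _ (ihB h)]
  | ex y A ih =>
    rcases v with v | v
    · cases h; exact List.mem_cons_self
    · exact List.mem_cons_of_mem _ (ih h)
  | all y A ih =>
    rcases v with v | v
    · cases h; exact List.mem_cons_self
    · exact List.mem_cons_of_mem _ (ih h)

theorem eq_of_lab_eq {A : Fml L} (hA : A.boundVars.Nodup) {v w : A.Vtx} {x : ℕ}
    (hv : A.lab v = .var x) (hw : A.lab w = .var x) : v = w := by
  induction A with
  | atom a => exact nomatch hv
  | and A B ihA ihB | or A B ihA ihB =>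
    have hd := (List.nodup_append'.1 hA)
    rcases v with v | v <;> rcases w with w | w
    · exact congrArg Sum.inl (ihA hd.1 hv hw)
    · exact (hd.2.2 (mem_boundVars_of_lab (A := A) hv) (mem_boundVars_of_lab (A := B) hw)).elim
    · exact (hd.2.2 (mem_boundVars_of_lab (A := A) hw) (mem_boundVars_of_lab (A := B) hv)).elim
    · exact congrArg Sum.inr (ihB hd.2.1 hv hw)
  | ex y A ih | all y A ih =>
    have hd := List.nodup_cons.1 hA
    rcases v with v | v <;> rcases w with w | w
    · rfl
    · cases hv; exact absurd (mem_boundVars_of_lab (A := A) hw) hd.1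
    · cases hw; exact absurd (mem_boundVars_of_lab (A := A) hv) hd.1
    · exact congrArg Sum.inr (ih hd.2 hv hw)

theorem mem_vars_of_lab {A : Fml L} {v : A.Vtx} {a : Atom L} {z : ℕ} (h : A.lab v = .atom a)
    (hz : z ∈ a.vars) : z ∈ A.freeVars ∨ z ∈ A.boundVars := by
  induction A with
  | atom b => cases h; exact Or.inl hz
  | and A B ihA ihB | or A B ihA ihB =>
    simp only [freeVars, boundVars, Finset.mem_union, List.mem_append]
    rcases v with v | v
    · exact (ihA h).imp Or.inl Or.inl
    · exact (ihB h).imp Or.inr Or.inr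
  | ex y A ih | all y A ih =>
    simp only [freeVars, boundVars, Finset.mem_erase, List.mem_cons]
    rcases v with v | v
    · exact nomatch h
    · have := ih h
      tauto

theorem ne_ff_of_fFree {A : Fml L} (hA : A.FFree) {v : A.Vtx} {a : Atom L}
    (h : A.lab v = .atom a) : a ≠ .ff := by
  induction A with
  | atom b => cases h; exact hA
  | and A B ihA ihB => rcases v with v | v; exacts [ihA hA.1 h, ihB hA.2 h]
  | or A B ihA ihB => rcases v with v | v; exacts [ihA hA.1 h, ihB hA.2 h]
  | ex x A ih => rcases v with v | v; exacts [(nomatch h), ih hA h]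
  | all x A ih => rcases v with v | v; exacts [(nomatch h), ih hA h]

/-! ### Rectified formulas -/

theorem Rectified.of_append {A B C : Fml L} (hb : C.boundVars = A.boundVars ++ B.boundVars)
    (hf : C.freeVars = A.freeVars ∪ B.freeVars) (h : C.Rectified) :
    A.Rectified ∧ B.Rectified ∧ List.Disjoint A.boundVars B.boundVars ∧
      (∀ x ∈ A.boundVars, x ∉ B.freeVars) ∧ ∀ x ∈ B.boundVars, x ∉ A.freeVars := by
  obtain ⟨h1, h2⟩ := h
  rw [hb] at h1 h2
  rw [hf] at h2
  simp only [List.mem_append, Finset.mem_union, not_or] at h2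
  have hd := List.nodup_append'.1 h1
  exact ⟨⟨hd.1, fun x hx => (h2 x (.inl hx)).1⟩, ⟨hd.2.1, fun x hx => (h2 x (.inr hx)).2⟩, hd.2.2,
    fun x hx => (h2 x (.inl hx)).2, fun x hx => (h2 x (.inr hx)).1⟩

theorem Rectified.of_cons {A C : Fml L} {y : ℕ} (hb : C.boundVars = y :: A.boundVars)
    (hf : C.freeVars = A.freeVars.erase y) (h : C.Rectified) :
    A.Rectified ∧ y ∉ A.boundVars := by
  obtain ⟨h1, h2⟩ := h
  rw [hb] at h1 h2
  rw [hf] at h2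
  have hd := List.nodup_cons.1 h1
  refine ⟨⟨hd.2, fun x hx hx' => h2 x (List.mem_cons_of_mem _ hx) ?_⟩, hd.1⟩
  exact Finset.mem_erase.2 ⟨fun e => hd.1 (e ▸ hx), hx'⟩

/-! ### Substitution -/

theorem kind_substVtx (σ : ℕ → L.Term ℕ) (A : Fml L) (v : A.Vtx) :
    (A.subst σ).kind (substVtx σ A v) = A.kind v := by
  induction A generalizing σ with
  | atom a => rfl
  | and A B ihA ihB => rcases v with v | v; exacts [ihA σ v, ihB σ v]
  | or A B ihA ihB => rcases v with v | v; exacts [ihA σ v, ihB σ v]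
  | ex x A ih => rcases v with v | v; exacts [rfl, ih _ v]
  | all x A ih => rcases v with v | v; exacts [rfl, ih _ v]

theorem val_subst (σ : ℕ → L.Term ℕ) (A : Fml L) (w : (A.subst σ).Vtx → SignType) :
    (A.subst σ).val w = A.val fun v => w (substVtx σ A v) := by
  induction A generalizing σ with
  | atom a => rfl
  | and A B ihA ihB => exact congrArg₂ tens (ihA σ _) (ihB σ _)
  | or A B ihA ihB => exact congrArg₂ par (ihA σ _) (ihB σ _)
  | ex x A ih => exact congrArg (tens _) (ih _ _)
  | all x A ih => exact congrArg (par _) (ih _ _)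

theorem fFree_subst {σ : ℕ → L.Term ℕ} {A : Fml L} : (A.subst σ).FFree ↔ A.FFree := by
  induction A generalizing σ with
  | atom a => exact not_congr Atom.subst_eq_ff
  | and A B ihA ihB => exact and_congr ihA ihB
  | or A B ihA ihB => exact and_congr ihA ihB
  | ex x A ih => exact ih
  | all x A ih => exact ih

end Fml

/-- Application of a substitution to the atoms among the labels. -/
def Label.subst {L : FirstOrder.Language.{u, v}} (σ : ℕ → L.Term ℕ) : Label L → Label L
  | .atom a => .atom (a.subst σ)
  | .var x => .var x

namespace Fml

variable {L : FirstOrder.Language.{u, v}}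

theorem lab_substVtx {σ : ℕ → L.Term ℕ} {A : Fml L} (h : ∀ y ∈ A.boundVars, σ y = Term.var y)
    (v : A.Vtx) : (A.subst σ).lab (substVtx σ A v) = (A.lab v).subst σ := by
  induction A generalizing σ with
  | atom a => rfl
  | and A B ihA ihB | or A B ihA ihB =>
    simp only [boundVars, List.mem_append] at h
    rcases v with v | v
    exacts [ihA (fun y hy => h y (.inl hy)) v, ihB (fun y hy => h y (.inr hy)) v]
  | ex y A ih | all y A ih =>
    simp only [boundVars, List.mem_cons] at h
    have hσ : Function.update σ y (Term.var y) = σ := by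
      rw [Function.update_eq_self_iff, h y (.inl rfl)]
    rcases v with v | v
    · rfl
    · refine (ih (fun z hz => ?_) v).trans (by rw [hσ]; rfl)
      rw [hσ]
      exact h z (.inr hz)

/-- As `x` does occur and `t` is not captured, all variables of `t` become visible in the premise of
the existential rule. This later shows which binders can bind them. -/
theorem subset_freeVars_subst {x : ℕ} {t : L.Term ℕ} {A : Fml L} (h : A.FreeFor x t)
    (hx : x ∈ A.freeVars) (hb : x ∉ A.boundVars) :
    t.varFinset ⊆ (A.subst (single x t)).freeVars := by
  induction A with
  | atom a =>
    intro z hz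
    exact Atom.mem_vars_subst.2 ⟨x, hx, by rwa [single_self]⟩
  | and A B ihA ihB | or A B ihA ihB =>
    simp only [boundVars, List.mem_append, not_or] at hb
    rcases Finset.mem_union.1 hx with hx | hx
    · exact (ihA h.1 hx hb.1).trans Finset.subset_union_left
    · exact (ihB h.2 hx hb.2).trans Finset.subset_union_right
  | ex y A ih | all y A ih =>
    simp only [boundVars, List.mem_cons, not_or] at hb
    rcases h with h | ⟨hy, h⟩
    · exact absurd hx h
    · intro z hz
      simp only [subst, freeVars]
      rw [update_single_of_ne t (Ne.symm hb.1)]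
      exact Finset.mem_erase.2 ⟨fun e => hy (e ▸ hz), ih h (Finset.mem_of_mem_erase hx) hb.2 hz⟩

end Fml

/-! ### Invariance under equivalence of formulas -/

namespace FEquiv

variable {L : FirstOrder.Language.{u, v}}

theorem kind_vtx {A B : Fml L} (e : FEquiv A B) (v : A.Vtx) : B.kind (e.vtx v) = A.kind v := by
  induction e with
  | refl => rfl
  | symm e ih => rw [← ih]; simp [vtx]
  | trans e f ihe ihf => rw [← ihe, ← ihf]; rfl
  | andCongr e f ihe ihf => rcases v with v | v; exacts [ihe v, ihf v]
  | orCongr e f ihe ihf => rcases v with v | v; exacts [ihe v, ihf v]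
  | exCongr x e ih => rcases v with v | v; exacts [rfl, ih v]
  | allCongr x e ih => rcases v with v | v; exacts [rfl, ih v]
  | andComm | orComm => rcases v with v | v <;> rfl
  | andAssoc | orAssoc => rcases v with (v | v) | v <;> rfl
  | allSwap | exSwap => rcases v with v | v | v <;> rfl
  | allOr | exAnd => rcases v with v | v | v <;> rfl

theorem lab_vtx {A B : Fml L} (e : FEquiv A B) (v : A.Vtx) : B.lab (e.vtx v) = A.lab v := by
  induction e with
  | refl => rfl
  | symm e ih => rw [← ih]; simp [vtx]
  | trans e f ihe ihf => rw [← ihe, ← ihf]; rfl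
  | andCongr e f ihe ihf => rcases v with v | v; exacts [ihe v, ihf v]
  | orCongr e f ihe ihf => rcases v with v | v; exacts [ihe v, ihf v]
  | exCongr x e ih => rcases v with v | v; exacts [rfl, ih v]
  | allCongr x e ih => rcases v with v | v; exacts [rfl, ih v]
  | andComm | orComm => rcases v with v | v <;> rfl
  | andAssoc | orAssoc => rcases v with (v | v) | v <;> rfl
  | allSwap | exSwap => rcases v with v | v | v <;> rfl
  | allOr | exAnd => rcases v with v | v | v <;> rfl

theorem val_vtx {A B : Fml L} (e : FEquiv A B) (w : B.Vtx → SignType) :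
    (A.val fun v => w (e.vtx v)) = B.val w := by
  induction e with
  | refl => rfl
  | symm e ih => rw [← ih]; simp [vtx]
  | trans e f ihe ihf => rw [← ihf, ← ihe]; rfl
  | andCongr e f ihe ihf => exact congrArg₂ tens (ihe fun v => w (.inl v)) (ihf fun v => w (.inr v))
  | orCongr e f ihe ihf => exact congrArg₂ par (ihe fun v => w (.inl v)) (ihf fun v => w (.inr v))
  | exCongr x e ih => exact congrArg (tens _) (ih fun v => w (.inr v))
  | allCongr x e ih => exact congrArg (par _) (ih fun v => w (.inr v))
  | andComm => exact tens_comm _ _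
  | orComm => exact par_comm _ _
  | andAssoc => exact tens_assoc _ _ _
  | orAssoc => exact par_assoc _ _ _
  | allSwap =>
    exact (par_assoc _ _ _).symm.trans
      ((congrArg (par · _) (par_comm _ _)).trans (par_assoc _ _ _))
  | exSwap =>
    exact (tens_assoc _ _ _).symm.trans
      ((congrArg (tens · _) (tens_comm _ _)).trans (tens_assoc _ _ _))
  | allOr => exact (par_assoc _ _ _).symm
  | exAnd => exact (tens_assoc _ _ _).symm

theorem fFree_iff {A B : Fml L} (e : FEquiv A B) : A.FFree ↔ B.FFree := by
  induction e with
  | refl => rfl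
  | symm e ih => exact ih.symm
  | trans e f ihe ihf => exact ihe.trans ihf
  | andCongr e f ihe ihf | orCongr e f ihe ihf => exact and_congr ihe ihf
  | exCongr x e ih | allCongr x e ih => exact ih
  | andComm | orComm => exact and_comm
  | andAssoc | orAssoc => exact and_assoc
  | allSwap | exSwap | allOr | exAnd => rfl

end FEquiv

/-! ### Matchings in the graph of a formula -/

section Matching

/-- On the support of `w` every vertex has at most one neighbour, and the vertices with value `1`
have a neighbour with value `-1`. -/
def IsMatchingSign {V : Type} (G : SimpleGraph V) (w : V → SignType) : Prop :=
  (∀ v x y, w v ≠ 0 → w x ≠ 0 → w y ≠ 0 → G.Adj v x → G.Adj v y → x = y) ∧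
    ∀ v, w v = 1 → ∃ x, w x = -1 ∧ G.Adj v x

/-- The value is `-1`, unless all vertices have the value `0`. -/
def IsNegative {V : Type} (w : V → SignType) (p : SignType) : Prop :=
  (∃ v, w v ≠ 0) → p = -1

/-- If the support meets both sides of a join, uniqueness of neighbours leaves a single vertex on
each side. Since a vertex of value `1` needs a neighbour of value `-1`, one of the two has value
`-1`; its factor is then `-1`, which absorbs. The condition puts no such demand on vertices of value
`-1`, so that the factor that holds this vertex, isolated in the support, still satisfies it. -/
theorem IsSumGraph.isNegative_tens {V W : Type} {K : SimpleGraph (V ⊕ W)} {G : SimpleGraph V}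
    {H : SimpleGraph W} (hK : IsSumGraph K G H True) {w : V ⊕ W → SignType} {p q : SignType}
    (hp : IsMatchingSign G (fun v => w (.inl v)) → IsNegative (fun v => w (.inl v)) p)
    (hq : IsMatchingSign H (fun v => w (.inr v)) → IsNegative (fun v => w (.inr v)) q)
    (hp0 : (∀ v, w (.inl v) = 0) → p = 0) (hq0 : (∀ v, w (.inr v) = 0) → q = 0)
    (h : IsMatchingSign K w) : IsNegative w (tens p q) := by
  obtain ⟨h1, h2⟩ := h
  have hG1 : ∀ v x y, w (.inl v) ≠ 0 → w (.inl x) ≠ 0 → w (.inl y) ≠ 0 → G.Adj v x → G.Adj v y →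
      x = y := fun v x y hv hx hy hvx hvy =>
    Sum.inl_injective (h1 _ _ _ hv hx hy ((hK.inl _ _).2 hvx) ((hK.inl _ _).2 hvy))
  have hH1 : ∀ v x y, w (.inr v) ≠ 0 → w (.inr x) ≠ 0 → w (.inr y) ≠ 0 → H.Adj v x → H.Adj v y →
      x = y := fun v x y hv hx hy hvx hvy =>
    Sum.inr_injective (h1 _ _ _ hv hx hy ((hK.inr _ _).2 hvx) ((hK.inr _ _).2 hvy))
  rintro ⟨v, hv⟩
  by_cases hl : ∀ v, w (.inl v) = 0
  · rw [hp0 hl, zero_tens]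
    refine hq ⟨hH1, fun u hu => ?_⟩ ?_
    · obtain ⟨x | x, hx, hux⟩ := h2 _ hu
      · simp [hl] at hx
      · exact ⟨x, hx, (hK.inr _ _).1 hux⟩
    · rcases v with v | v
      exacts [absurd (hl v) hv, ⟨v, hv⟩]
  by_cases hr : ∀ v, w (.inr v) = 0
  · rw [hq0 hr, tens_zero]
    refine hp ⟨hG1, fun u hu => ?_⟩ ?_
    · obtain ⟨x | x, hx, hux⟩ := h2 _ hu
      · exact ⟨x, hx, (hK.inl _ _).1 hux⟩
      · simp [hr] at hx
    · rcases v with v | v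
      exacts [⟨v, hv⟩, absurd (hr v) hv]
  push Not at hl hr
  obtain ⟨a, ha⟩ := hl
  obtain ⟨b, hb⟩ := hr
  have hab : K.Adj (.inl a) (.inr b) := (hK.inl_inr a b).2 trivial
  have hla : ∀ v, w (.inl v) ≠ 0 → v = a := fun v hv =>
    Sum.inl_injective (h1 (.inr b) _ _ hb hv ha ((hK.inr_inl _ _).2 trivial) hab.symm)
  have hrb : ∀ v, w (.inr v) ≠ 0 → v = b := fun v hv =>
    Sum.inr_injective (h1 (.inl a) _ _ ha hv hb ((hK.inl_inr _ _).2 trivial) hab)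
  by_cases hw : w (.inl a) = -1
  · have : p = -1 := by
      refine hp ⟨hG1, fun u hu => ?_⟩ ⟨a, ha⟩
      have := hla u (by simp [hu])
      simp only [this, hw] at hu
      exact absurd hu (by decide)
    simp [tens, this]
  · have hwa : w (.inl a) = 1 := by
      cases hs : w (.inl a) with
      | zero => exact absurd hs ha
      | neg => exact absurd hs hw
      | pos => rfl
    obtain ⟨x, hx, hax⟩ := h2 _ hwa
    obtain rfl : x = .inr b := h1 _ _ _ ha (by simp [hx]) hb hax hab
    have : q = -1 := by
      refine hq ⟨hH1, fun u hu => ?_⟩ ⟨b, hb⟩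
      have := hrb u (by simp [hu])
      simp only [this, hx] at hu
      exact absurd hu (by decide)
    simp [tens, this]

/-- No edge crosses, so both sides inherit the condition; a side without support contributes the
unit `0`. -/
theorem IsSumGraph.isNegative_par {V W : Type} {K : SimpleGraph (V ⊕ W)} {G : SimpleGraph V}
    {H : SimpleGraph W} (hK : IsSumGraph K G H False) {w : V ⊕ W → SignType} {p q : SignType}
    (hp : IsMatchingSign G (fun v => w (.inl v)) → IsNegative (fun v => w (.inl v)) p)
    (hq : IsMatchingSign H (fun v => w (.inr v)) → IsNegative (fun v => w (.inr v)) q)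
    (hp0 : (∀ v, w (.inl v) = 0) → p = 0) (hq0 : (∀ v, w (.inr v) = 0) → q = 0)
    (h : IsMatchingSign K w) : IsNegative w (par p q) := by
  obtain ⟨h1, h2⟩ := h
  have hp := hp ⟨fun v x y hv hx hy hvx hvy =>
    Sum.inl_injective (h1 _ _ _ hv hx hy ((hK.inl _ _).2 hvx) ((hK.inl _ _).2 hvy)), fun u hu => by
      obtain ⟨x | x, hx, hux⟩ := h2 _ hu
      · exact ⟨x, hx, (hK.inl _ _).1 hux⟩
      · exact ((hK.inl_inr _ _).1 hux).elim⟩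
  have hq := hq ⟨fun v x y hv hx hy hvx hvy =>
    Sum.inr_injective (h1 _ _ _ hv hx hy ((hK.inr _ _).2 hvx) ((hK.inr _ _).2 hvy)), fun u hu => by
      obtain ⟨x | x, hx, hux⟩ := h2 _ hu
      · exact ((hK.inr_inl _ _).1 hux).elim
      · exact ⟨x, hx, (hK.inr _ _).1 hux⟩⟩
  rintro ⟨v, hv⟩
  by_cases hl : ∀ v, w (.inl v) = 0
  · rw [hp0 hl, zero_par]
    rcases v with v | v
    exacts [absurd (hl v) hv, hq ⟨v, hv⟩]
  by_cases hr : ∀ v, w (.inr v) = 0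
  · rw [hq0 hr, par_zero]
    rcases v with v | v
    exacts [hp ⟨v, hv⟩, absurd (hr v) hv]
  push Not at hl hr
  rw [hp hl, hq hr]
  decide

theorem isNegative_unit {w : Unit → SignType} (h : IsMatchingSign ⊥ w) : IsNegative w (w ()) := by
  rintro ⟨v, hv⟩
  cases hs : w () with
  | zero => exact absurd hs hv
  | neg => rfl
  | pos =>
    obtain ⟨x, -, hx⟩ := h.2 () hs
    exact hx.elim

namespace Fml

variable {L : FirstOrder.Language.{u, v}}

theorem val_eq_zero (A : Fml L) {w : A.Vtx → SignType} (h : ∀ v, w v = 0) : A.val w = 0 := by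
  induction A with
  | atom a => exact h _
  | and A B ihA ihB =>
    simp only [val, ihA fun v => h (.inl v), ihB fun v => h (.inr v)]; decide
  | or A B ihA ihB =>
    simp only [val, ihA fun v => h (.inl v), ihB fun v => h (.inr v)]; decide
  | ex x A ih => simp only [val, h (.inl ()), ih fun v => h (.inr v)]; decide
  | all x A ih => simp only [val, h (.inl ()), ih fun v => h (.inr v)]; decide

theorem isNegative_val (A : Fml L) (w : A.Vtx → SignType) (h : IsMatchingSign A.toGraph.graph w) :
    IsNegative w (A.val w) := by
  induction A with
  | atom a => exact isNegative_unit h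
  | and A B ihA ihB =>
    exact (isSumGraph_join _ _).isNegative_tens (ihA _) (ihB _) A.val_eq_zero B.val_eq_zero h
  | or A B ihA ihB =>
    exact (isSumGraph_union _ _).isNegative_par (ihA _) (ihB _) A.val_eq_zero B.val_eq_zero h
  | ex x A ih =>
    exact (isSumGraph_join _ _).isNegative_tens isNegative_unit (ih _) (fun h => h ())
      A.val_eq_zero h
  | all x A ih =>
    exact (isSumGraph_union _ _).isNegative_par isNegative_unit (ih _) (fun h => h ())
      A.val_eq_zero h

/-! ### The graph of a formula -/

theorem isCograph_single {L : FirstOrder.Language.{u, v}} (l : Label L) :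
    IsCograph (LabelledGraph.single l).graph :=
  isCograph_iff.2 fun _ _ _ _ h => h.elim

theorem isCograph_toGraph (A : Fml L) : IsCograph A.toGraph.graph := by
  induction A with
  | atom a => exact isCograph_single _
  | and A B ihA ihB => exact (isSumGraph_join _ _).isCograph ihA ihB
  | or A B ihA ihB => exact (isSumGraph_union _ _).isCograph ihA ihB
  | ex x A ih => exact (isSumGraph_join _ _).isCograph (isCograph_single _) ih
  | all x A ih => exact (isSumGraph_union _ _).isCograph (isCograph_single _) ih

theorem isHull_univ {V : Type} {K : SimpleGraph (Unit ⊕ V)} {G : SimpleGraph V}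
    {H : SimpleGraph Unit} {c : Prop} (h : IsSumGraph K H G c) [Nonempty V] :
    IsHull K (.inl ()) Set.univ := by
  have e : (Set.univ \ {.inl ()} : Set (Unit ⊕ V)) = Sum.inr '' Set.univ := by
    ext (v | v) <;> simp
  refine ⟨trivial, isModule_univ K, ?_, ?_⟩ <;> rw [e]
  · exact h.embedding_inr.isModule_image (isModule_univ _)
  · exact Set.univ_nonempty.image _

/-- The hull is the subformula that starts with the quantifier. A literal in the range of the
quantifier reveals the kind of the binder by its adjacency to it. -/
theorem exists_isHull (A : Fml L) (b : A.Vtx) (hb : A.kind b ≠ .lit) :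
    ∃ N, IsHull A.toGraph.graph b N ∧
      ∃ v ∈ N, v ≠ b ∧ A.kind v = .lit ∧ (A.toGraph.graph.Adj b v ↔ A.kind b = .ex) := by
  have lift {V W : Type} {G : SimpleGraph V} {K : SimpleGraph W} {φ : V → W} {b : V}
      {k : V → Kind} {k' : W → Kind} (hφ : IsModuleEmbedding G K φ) (hk : ∀ v, k' (φ v) = k v)
      (h : ∃ N, IsHull G b N ∧ ∃ v ∈ N, v ≠ b ∧ k v = .lit ∧ (G.Adj b v ↔ k b = .ex)) :
      ∃ N, IsHull K (φ b) N ∧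
        ∃ v ∈ N, v ≠ φ b ∧ k' v = .lit ∧ (K.Adj (φ b) v ↔ k' (φ b) = .ex) := by
    obtain ⟨N, hN, v, hv, hvb, hkv, hadj⟩ := h
    refine ⟨_, hN.image hφ, φ v, ⟨v, hv, rfl⟩, fun e => hvb (hφ.inj e), (hk v).trans hkv, ?_⟩
    rw [hφ.adj, hk]
    exact hadj
  induction A with
  | atom a => exact absurd rfl hb
  | and A B ihA ihB =>
    rcases b with b | b
    · exact lift (k' := (and A B).kind) (isSumGraph_join _ _).embedding_inl (fun _ => rfl)
        (ihA b hb)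
    · exact lift (k' := (and A B).kind) (isSumGraph_join _ _).embedding_inr (fun _ => rfl)
        (ihB b hb)
  | or A B ihA ihB =>
    rcases b with b | b
    · exact lift (k' := (or A B).kind) (isSumGraph_union _ _).embedding_inl (fun _ => rfl)
        (ihA b hb)
    · exact lift (k' := (or A B).kind) (isSumGraph_union _ _).embedding_inr (fun _ => rfl)
        (ihB b hb)
  | ex x A ih =>
    rcases b with b | b
    · obtain ⟨v, hv⟩ := A.exists_kind_eq_lit
      have : Nonempty A.Vtx := ⟨v⟩
      refine ⟨_, isHull_univ (isSumGraph_join _ _), .inr v, trivial, nofun, hv, ?_⟩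
      exact ((isSumGraph_join _ _).inl_inr _ _).trans ⟨fun _ => rfl, fun _ => trivial⟩
    · exact lift (k' := (ex x A).kind) (isSumGraph_join _ _).embedding_inr (fun _ => rfl)
        (ih b hb)
  | all x A ih =>
    rcases b with b | b
    · obtain ⟨v, hv⟩ := A.exists_kind_eq_lit
      have : Nonempty A.Vtx := ⟨v⟩
      refine ⟨_, isHull_univ (isSumGraph_union _ _), .inr v, trivial, nofun, hv, ?_⟩
      exact ((isSumGraph_union _ _).inl_inr _ _).trans ⟨False.elim, nofun⟩
    · exact lift (k' := (all x A).kind) (isSumGraph_union _ _).embedding_inr (fun _ => rfl)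
        (ih b hb)

/-- From the quantifier one climbs through conjunctions and existential quantifiers, all of whose
vertices are adjacent to `b`. Either this exhausts the formula, or it stops below a disjunction or a
universal quantifier; the part reached is then `P`, and one step further gives `N`. -/
theorem dominated_or_exists_isDominated (A : Fml L) (b : A.Vtx) (hb : A.kind b = .ex) :
    ((∃ v, v ≠ b) ∧ ∀ v, v ≠ b → A.toGraph.graph.Adj b v) ∨
      ∃ P N, IsDominated A.toGraph.graph b P N := by
  have lift {V W : Type} {G : SimpleGraph V} {K : SimpleGraph W} {φ : V → W} {b : V}
      (hφ : IsModuleEmbedding G K φ) (hout : (∀ w, (∀ v, φ v ≠ w) → K.Adj (φ b) w) ∨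
        ((∀ v w, (∀ v, φ v ≠ w) → ¬ K.Adj (φ v) w) ∧ ∃ w, ∀ v, φ v ≠ w))
      (h : ((∃ v, v ≠ b) ∧ ∀ v, v ≠ b → G.Adj b v) ∨ ∃ P N, IsDominated G b P N) :
      ((∃ v, v ≠ φ b) ∧ ∀ v, v ≠ φ b → K.Adj (φ b) v) ∨ ∃ P N, IsDominated K (φ b) P N := by
    rcases h with ⟨⟨v₀, hv₀⟩, h⟩ | ⟨P, N, h⟩
    · rcases hout with hout | ⟨hout, w, hw⟩
      · refine Or.inl ⟨⟨φ v₀, fun e => hv₀ (hφ.inj e)⟩, fun w hw => ?_⟩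
        by_cases hc : ∃ v, φ v = w
        · obtain ⟨v, rfl⟩ := hc
          exact (hφ.adj _ _).2 (h v fun e => hw (e ▸ rfl))
        · push Not at hc
          exact hout w hc
      · refine Or.inr ⟨φ '' Set.univ, Set.univ, ⟨b, trivial, rfl⟩, ?_, ?_, Set.subset_univ _,
          hφ.isModule_image (isModule_univ _), isModule_univ _, ⟨w, trivial, ?_⟩, ?_⟩
        · exact Set.Nontrivial.image ⟨v₀, trivial, b, trivial, hv₀⟩ hφ.inj
        · rintro _ ⟨v, -, rfl⟩ hvb
          exact (hφ.adj _ _).2 (h v fun e => hvb (e ▸ rfl))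
        · rintro ⟨v, -, hv⟩
          exact hw v hv
        · rintro _ ⟨v, -, rfl⟩ w - hw
          exact hout v w fun u hu => hw ⟨u, trivial, hu⟩
    · exact Or.inr ⟨_, _, h.image hφ⟩
  induction A with
  | atom a => exact nomatch hb
  | and A B ihA ihB =>
    have hs := isSumGraph_join A.toGraph B.toGraph
    rcases b with b | b
    · refine lift hs.embedding_inl (Or.inl ?_) (ihA b hb)
      rintro (w | w) hw
      exacts [absurd rfl (hw w), (hs.inl_inr _ _).2 trivial]
    · refine lift hs.embedding_inr (Or.inl ?_) (ihB b hb)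
      rintro (w | w) hw
      exacts [(hs.inr_inl _ _).2 trivial, absurd rfl (hw w)]
  | or A B ihA ihB =>
    have hs := isSumGraph_union A.toGraph B.toGraph
    rcases b with b | b
    · refine lift hs.embedding_inl (Or.inr ⟨?_, ?_⟩) (ihA b hb)
      · rintro v (w | w) hw
        exacts [absurd rfl (hw w), (hs.inl_inr _ _).1]
      · exact (B.exists_kind_eq_lit).imp' Sum.inr fun _ _ => nofun
    · refine lift hs.embedding_inr (Or.inr ⟨?_, ?_⟩) (ihB b hb)
      · rintro v (w | w) hw
        exacts [(hs.inr_inl _ _).1, absurd rfl (hw w)]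
      · exact (A.exists_kind_eq_lit).imp' Sum.inl fun _ _ => nofun
  | ex x A ih =>
    have hs := isSumGraph_join (LabelledGraph.single (.var x)) A.toGraph
    rcases b with b | b
    · refine Or.inl ⟨(A.exists_kind_eq_lit).imp' Sum.inr fun _ _ => nofun, ?_⟩
      rintro (w | w) hw
      exacts [absurd rfl hw, (hs.inl_inr _ _).2 trivial]
    · refine lift hs.embedding_inr (Or.inl ?_) (ih b hb)
      rintro (w | w) hw
      exacts [(hs.inr_inl _ _).2 trivial, absurd rfl (hw w)]
  | all x A ih =>
    have hs := isSumGraph_union (LabelledGraph.single (.var x)) A.toGraph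
    rcases b with b | b
    · exact nomatch hb
    · refine lift hs.embedding_inr (Or.inr ⟨?_, ⟨.inl (), nofun⟩⟩) (ih b hb)
      rintro v (w | w) hw
      exacts [(hs.inr_inl _ _).1, absurd rfl (hw w)]

theorem isBinder_iff {A : Fml L} {b : A.Vtx} : A.toGraph.IsBinder b ↔ A.kind b ≠ .lit := by
  simp only [LabelledGraph.IsBinder, toGraph_label]
  exact ⟨fun ⟨_, h⟩ => kind_ne_lit_of_lab h, lab_of_kind_ne_lit⟩

theorem isExistential_iff {A : Fml L} {b : A.Vtx} :
    A.toGraph.IsExistential b ↔ A.kind b = .ex := by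
  constructor
  · rintro ⟨hb, h⟩
    obtain ⟨N, hN, v, hv, hvb, -, hadj⟩ := A.exists_isHull b (isBinder_iff.1 hb)
    exact hadj.1 (h v (hN.subset_scope hv) hvb)
  · intro hb
    refine ⟨isBinder_iff.2 (by simp [hb]), fun v hv hvb => ?_⟩
    rcases A.dominated_or_exists_isDominated b hb with h | ⟨P, N, h⟩
    · exact h.2 v hvb
    · exact h.adj v (h.scope_subset hv) hvb

/-- This direction suffices, as dependencies only have to be bounded from above. -/
theorem kind_of_isUniversal {A : Fml L} {b : A.Vtx} (h : A.toGraph.IsUniversal b) :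
    A.kind b = .all := by
  obtain ⟨hb, h⟩ := h
  rw [isBinder_iff] at hb
  obtain ⟨N, hN, v, hv, hvb, -, hadj⟩ := A.exists_isHull b hb
  have := h v (hN.subset_scope hv) hvb
  rw [hadj] at this
  cases hk : A.kind b with
  | lit => exact absurd hk hb
  | ex => exact absurd hk this
  | all => rfl

theorem isFograph_toGraph {A : Fml L} (hA : A.Rectified) : A.toGraph.IsFograph := by
  have hlit {v : A.Vtx} (h : A.kind v = .lit) : A.toGraph.IsLiteral v := by
    simp only [LabelledGraph.IsLiteral, toGraph_label]
    exact lab_of_kind_eq_lit h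
  refine ⟨⟨A.isCograph_toGraph, A.exists_kind_eq_lit.imp fun _ => hlit⟩, fun b hb => ⟨?_, ?_⟩⟩
  · intro c _ hcb h
    rw [toGraph_label, toGraph_label] at h
    obtain ⟨x, hx⟩ := lab_of_kind_ne_lit (isBinder_iff.1 hb)
    exact hcb (eq_of_lab_eq hA.1 (h.trans hx) hx)
  · obtain ⟨N, hN, v, hv, -, hlv, -⟩ := A.exists_isHull b (isBinder_iff.1 hb)
    exact ⟨v, hN.subset_scope hv, hlit hlv⟩

end Fml

end Matching

/-! ### Formulas in contexts -/

namespace Ctx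

variable {L : FirstOrder.Language.{u, v}}

/-- The occurrences in a formula as occurrences in a context that is filled with it. -/
def incl {Q : Fml L} : (S : Ctx L) → Q.Vtx → (S.fill Q).Vtx
  | hole => id
  | andL S _ => fun o => .inl (S.incl o)
  | andR _ S => fun o => .inr (S.incl o)
  | orL S _ => fun o => .inl (S.incl o)
  | orR _ S => fun o => .inr (S.incl o)
  | ex _ S => fun o => .inr (S.incl o)
  | all _ S => fun o => .inr (S.incl o)

/-- The quantifier occurrences of a context that have the hole in their range. -/
def Above {Q : Fml L} : (S : Ctx L) → (S.fill Q).Vtx → Prop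
  | hole => fun _ => False
  | andL S _ => Sum.elim S.Above fun _ => False
  | andR _ S => Sum.elim (fun _ => False) S.Above
  | orL S _ => Sum.elim S.Above fun _ => False
  | orR _ S => Sum.elim (fun _ => False) S.Above
  | ex _ S => Sum.elim (fun _ => True) S.Above
  | all _ S => Sum.elim (fun _ => True) S.Above

variable {P Q : Fml L} {f : Q.Vtx → Option P.Vtx}

theorem lab_incl (S : Ctx L) (o : Q.Vtx) : (S.fill Q).lab (S.incl o) = Q.lab o := by
  induction S with
  | hole => rfl
  | andL _ _ ih | andR _ _ ih | orL _ _ ih | orR _ _ ih | ex _ _ ih | all _ _ ih => exact ih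

theorem kind_incl (S : Ctx L) (o : Q.Vtx) : (S.fill Q).kind (S.incl o) = Q.kind o := by
  induction S with
  | hole => rfl
  | andL _ _ ih | andR _ _ ih | orL _ _ ih | orR _ _ ih | ex _ _ ih | all _ _ ih => exact ih

theorem incl_injective (S : Ctx L) : Function.Injective (S.incl (Q := Q)) := by
  induction S with
  | hole => exact fun _ _ => id
  | andL _ _ ih | orL _ _ ih => exact Sum.inl_injective.comp ih
  | andR _ _ ih | orR _ _ ih | ex _ _ ih | all _ _ ih => exact Sum.inr_injective.comp ih

theorem not_above_incl (S : Ctx L) (o : Q.Vtx) : ¬ S.Above (S.incl o) := by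
  induction S with
  | hole => exact id
  | andL _ _ ih | andR _ _ ih | orL _ _ ih | orR _ _ ih | ex _ _ ih | all _ _ ih => exact ih

theorem Above.kind_ne_lit {S : Ctx L} {v : (S.fill Q).Vtx} (h : S.Above v) :
    (S.fill Q).kind v ≠ .lit := by
  induction S with
  | hole => exact h.elim
  | andL _ _ ih | orL _ _ ih =>
    rcases v with v | v
    exacts [ih h, h.elim]
  | andR _ _ ih | orR _ _ ih =>
    rcases v with v | v
    exacts [h.elim, ih h]
  | ex _ _ ih | all _ _ ih =>
    rcases v with v | v
    exacts [nofun, ih h]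

theorem extend_incl (S : Ctx L) (o : Q.Vtx) :
    S.extend f (S.incl o) = (f o).map S.incl := by
  induction S with
  | hole => exact Option.map_id'.symm
  | andL S _ ih | orL S _ ih =>
    exact (congrArg (Option.map Sum.inl) ih).trans (Option.map_map _ _ _)
  | andR _ S ih | orR _ S ih | ex _ S ih | all _ S ih =>
    exact (congrArg (Option.map Sum.inr) ih).trans (Option.map_map _ _ _)

/-- An occurrence in a filled context lies in the formula, or else has a counterpart when the
context is filled with another formula. -/
theorem extend_cases (S : Ctx L) (f : Q.Vtx → Option P.Vtx) (v : (S.fill Q).Vtx) :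
    (∃ o, v = S.incl o) ∨ ∃ v', S.extend f v = some v' ∧ (S.fill P).lab v' = (S.fill Q).lab v ∧
      (S.fill P).kind v' = (S.fill Q).kind v ∧ (S.Above v' ↔ S.Above v) := by
  induction S with
  | hole => exact Or.inl ⟨v, rfl⟩
  | andL S B ih | orL S B ih =>
    rcases v with v | v
    · exact (ih v).imp (fun ⟨o, h⟩ => ⟨o, congrArg Sum.inl h⟩)
        fun ⟨v', h, h'⟩ => ⟨.inl v', congrArg (Option.map Sum.inl) h, h'⟩
    · exact Or.inr ⟨.inr v, rfl, rfl, rfl, Iff.rfl⟩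
  | andR A S ih | orR A S ih =>
    rcases v with v | v
    · exact Or.inr ⟨.inl v, rfl, rfl, rfl, Iff.rfl⟩
    · exact (ih v).imp (fun ⟨o, h⟩ => ⟨o, congrArg Sum.inr h⟩)
        fun ⟨v', h, h'⟩ => ⟨.inr v', congrArg (Option.map Sum.inr) h, h'⟩
  | ex x S ih | all x S ih =>
    rcases v with v | v
    · exact Or.inr ⟨.inl v, rfl, rfl, rfl, Iff.rfl⟩
    · exact (ih v).imp (fun ⟨o, h⟩ => ⟨o, congrArg Sum.inr h⟩)
        fun ⟨v', h, h'⟩ => ⟨.inr v', congrArg (Option.map Sum.inr) h, h'⟩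

theorem extend_cases_of_eq_some {S : Ctx L} {v : (S.fill Q).Vtx} {v' : (S.fill P).Vtx}
    (h : S.extend f v = some v') : (∃ o p, v = S.incl o ∧ v' = S.incl p ∧ f o = some p) ∨
      (S.fill P).lab v' = (S.fill Q).lab v ∧ (S.fill P).kind v' = (S.fill Q).kind v ∧
        (S.Above v' ↔ S.Above v) := by
  rcases S.extend_cases f v with ⟨o, rfl⟩ | ⟨u, hu, hu'⟩
  · rw [extend_incl, Option.map_eq_some_iff] at h
    obtain ⟨p, hp, rfl⟩ := h
    exact Or.inl ⟨o, p, rfl, rfl, hp⟩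
  · rw [hu, Option.some.injEq] at h
    exact Or.inr (h ▸ hu')

theorem above_iff_of_extend {S : Ctx L} {v : (S.fill Q).Vtx} {v' : (S.fill P).Vtx}
    (h : S.extend f v = some v') : S.Above v' ↔ S.Above v := by
  rcases extend_cases_of_eq_some h with ⟨o, p, rfl, rfl, -⟩ | ⟨-, -, h⟩
  · exact iff_of_false (S.not_above_incl p) (S.not_above_incl o)
  · exact h

theorem Above.exists_extend {S : Ctx L} {v : (S.fill Q).Vtx} (h : S.Above v)
    (f : Q.Vtx → Option P.Vtx) : ∃ v', S.extend f v = some v' := by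
  rcases S.extend_cases f v with ⟨o, rfl⟩ | ⟨v', hv, -⟩
  exacts [absurd h (S.not_above_incl o), ⟨v', hv⟩]

theorem extend_eq_none {S : Ctx L} {v : (S.fill Q).Vtx} (h : S.extend f v = none) :
    ∃ o, v = S.incl o ∧ f o = none := by
  rcases S.extend_cases f v with ⟨o, rfl⟩ | ⟨v', hv, -⟩
  · rw [extend_incl, Option.map_eq_none_iff] at h
    exact ⟨o, rfl, h⟩
  · simp [h] at hv

theorem kind_of_extend (hf : ∀ o p, f o = some p → P.kind p = Q.kind o) {S : Ctx L}
    {v : (S.fill Q).Vtx} {v' : (S.fill P).Vtx} (h : S.extend f v = some v') :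
    (S.fill P).kind v' = (S.fill Q).kind v := by
  rcases extend_cases_of_eq_some h with ⟨o, p, rfl, rfl, hp⟩ | ⟨-, h, -⟩
  · rw [kind_incl, kind_incl, hf o p hp]
  · exact h

theorem extend_injective (hf : ∀ o o' p, f o = some p → f o' = some p → o = o') (S : Ctx L)
    (v v' : (S.fill Q).Vtx) (u : (S.fill P).Vtx) (h : S.extend f v = some u)
    (h' : S.extend f v' = some u) : v = v' := by
  induction S with
  | hole => exact hf v v' u h h'
  | andL S B ih | orL S B ih =>
    rcases v with v | v <;> rcases v' with v' | v'
    · obtain ⟨a, ha, rfl⟩ := Option.map_eq_some_iff.1 h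
      obtain ⟨b, hb, e⟩ := Option.map_eq_some_iff.1 h'
      cases e
      exact congrArg Sum.inl (ih v v' a ha hb)
    · obtain ⟨a, ha, rfl⟩ := Option.map_eq_some_iff.1 h
      exact nomatch h'
    · obtain ⟨a, ha, rfl⟩ := Option.map_eq_some_iff.1 h'
      exact nomatch h
    · cases h; cases h'; rfl
  | andR A S ih | orR A S ih | ex A S ih | all A S ih =>
    rcases v with v | v <;> rcases v' with v' | v'
    · cases h; cases h'; rfl
    · obtain ⟨a, ha, rfl⟩ := Option.map_eq_some_iff.1 h'
      exact nomatch h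
    · obtain ⟨a, ha, rfl⟩ := Option.map_eq_some_iff.1 h
      exact nomatch h'
    · obtain ⟨a, ha, rfl⟩ := Option.map_eq_some_iff.1 h
      obtain ⟨b, hb, e⟩ := Option.map_eq_some_iff.1 h'
      cases e
      exact congrArg Sum.inr (ih v v' a ha hb)

theorem extend_surjective (S : Ctx L) (f : Q.Vtx → Option P.Vtx) (v' : (S.fill P).Vtx) :
    (∃ v, S.extend f v = some v') ∨ ∃ p, v' = S.incl p ∧ ∀ o, f o ≠ some p := by
  induction S with
  | hole =>
    by_cases h : ∃ o, f o = some v'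
    · exact Or.inl h
    · exact Or.inr ⟨v', rfl, fun o ho => h ⟨o, ho⟩⟩
  | andL S B ih | orL S B ih =>
    rcases v' with v' | v'
    · exact (ih v').imp (fun ⟨v, h⟩ => ⟨.inl v, congrArg (Option.map Sum.inl) h⟩)
        fun ⟨p, h, h'⟩ => ⟨p, congrArg Sum.inl h, h'⟩
    · exact Or.inl ⟨.inr v', rfl⟩
  | andR A S ih | orR A S ih | ex A S ih | all A S ih =>
    rcases v' with v' | v'
    · exact Or.inl ⟨.inl v', rfl⟩
    · exact (ih v').imp (fun ⟨v, h⟩ => ⟨.inr v, congrArg (Option.map Sum.inr) h⟩)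
        fun ⟨p, h, h'⟩ => ⟨p, congrArg Sum.inr h, h'⟩

theorem exists_of_extend_eq_incl {S : Ctx L} {v : (S.fill Q).Vtx} {p : P.Vtx}
    (h : S.extend f v = some (S.incl p)) : ∃ o, f o = some p := by
  induction S with
  | hole => exact ⟨v, h⟩
  | andL S B ih | orL S B ih =>
    rcases v with v | v
    · obtain ⟨a, ha, e⟩ := Option.map_eq_some_iff.1 h
      cases Sum.inl_injective e
      exact ih ha
    · exact nomatch h
  | andR A S ih | orR A S ih | ex A S ih | all A S ih =>
    rcases v with v | v
    · exact nomatch h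
    · obtain ⟨a, ha, e⟩ := Option.map_eq_some_iff.1 h
      cases Sum.inr_injective e
      exact ih ha

theorem fFree_fill (h : Q.FFree → P.FFree) {S : Ctx L} (hS : (S.fill Q).FFree) :
    (S.fill P).FFree := by
  induction S with
  | hole => exact h hS
  | andL _ _ ih | orL _ _ ih => exact ⟨ih hS.1, hS.2⟩
  | andR _ _ ih | orR _ _ ih => exact ⟨hS.1, ih hS.2⟩
  | ex _ _ ih | all _ _ ih => exact ih hS

theorem mem_boundVars_fill {x : ℕ} (h : x ∈ Q.boundVars) (S : Ctx L) :
    x ∈ (S.fill Q).boundVars := by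
  induction S with
  | hole => exact h
  | andL _ _ ih | orL _ _ ih => exact List.mem_append_left _ ih
  | andR _ _ ih | orR _ _ ih => exact List.mem_append_right _ ih
  | ex _ _ ih | all _ _ ih => exact List.mem_cons_of_mem _ ih

theorem rectified_of_fill {S : Ctx L} (h : (S.fill Q).Rectified) : Q.Rectified := by
  induction S with
  | hole => exact h
  | andL _ _ ih | orL _ _ ih => exact ih (h.of_append rfl rfl).1
  | andR _ _ ih | orR _ _ ih => exact ih (h.of_append rfl rfl).2.1
  | ex _ _ ih | all _ _ ih => exact ih (h.of_cons rfl rfl).1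

/-- In a rectified formula a variable that is bound inside the hole can occur nowhere else. -/
theorem exists_eq_incl_of_mem_vars {S : Ctx L} (hS : (S.fill Q).Rectified) {x : ℕ}
    (hx : x ∈ Q.boundVars) {v : (S.fill Q).Vtx} {a : Atom L} (hv : (S.fill Q).lab v = .atom a)
    (hxa : x ∈ a.vars) : ∃ o, v = S.incl o := by
  induction S with
  | hole => exact ⟨v, rfl⟩
  | andL S B ih | orL S B ih =>
    have h := hS.of_append rfl rfl
    rcases v with v | v
    · exact (ih h.1 hv).imp fun _ => congrArg _
    · have hxS := mem_boundVars_fill hx S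
      rcases Fml.mem_vars_of_lab (A := B) hv hxa with hB | hB
      exacts [absurd hB (h.2.2.2.1 x hxS), (h.2.2.1 hxS hB).elim]
  | andR B S ih | orR B S ih =>
    have h := hS.of_append rfl rfl
    rcases v with v | v
    · have hxS := mem_boundVars_fill hx S
      rcases Fml.mem_vars_of_lab (A := B) hv hxa with hB | hB
      exacts [absurd hB (h.2.2.2.2 x hxS), (h.2.2.1 hB hxS).elim]
    · exact (ih h.2.1 hv).imp fun _ => congrArg _
  | ex y S ih | all y S ih =>
    have h := hS.of_cons rfl rfl
    rcases v with v | v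
    · exact nomatch hv
    · exact (ih h.1 hv).imp fun _ => congrArg _

theorem mem_freeVars_fill {z : ℕ} (hz : z ∈ P.freeVars) (S : Ctx L) :
    z ∈ (S.fill P).freeVars ∨ ∃ v : (S.fill P).Vtx, S.Above v ∧ (S.fill P).lab v = .var z := by
  induction S with
  | hole => exact Or.inl hz
  | andL S B ih | orL S B ih =>
    exact ih.imp (Finset.mem_union_left _) fun ⟨v, h⟩ => ⟨.inl v, h⟩
  | andR B S ih | orR B S ih =>
    exact ih.imp (Finset.mem_union_right _) fun ⟨v, h⟩ => ⟨.inr v, h⟩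
  | ex y S ih | all y S ih =>
    by_cases hzy : z = y
    · exact Or.inr ⟨.inl (), trivial, hzy ▸ rfl⟩
    · exact ih.imp (fun h => Finset.mem_erase.2 ⟨hzy, h⟩) fun ⟨v, h⟩ => ⟨.inr v, h⟩

theorem val_fill_le {S : Ctx L} {w : (S.fill Q).Vtx → SignType} {w' : (S.fill P).Vtx → SignType}
    (hw : ∀ v v', S.extend f v = some v' → w' v' = w v)
    (h : (P.val fun p => w' (S.incl p)) ≤ Q.val fun o => w (S.incl o)) :
    (S.fill P).val w' ≤ (S.fill Q).val w := by
  induction S with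
  | hole => exact h
  | andL S B ih =>
    refine tens_mono _ _ _ _
      (ih (fun v v' hv => hw (.inl v) (.inl v') (congrArg (Option.map Sum.inl) hv)) h) ?_
    exact le_of_eq (congrArg _ (funext fun v => hw (.inr v) (.inr v) rfl))
  | orL S B ih =>
    refine par_mono _ _ _ _
      (ih (fun v v' hv => hw (.inl v) (.inl v') (congrArg (Option.map Sum.inl) hv)) h) ?_
    exact le_of_eq (congrArg _ (funext fun v => hw (.inr v) (.inr v) rfl))
  | andR B S ih =>
    refine tens_mono _ _ _ _ ?_
      (ih (fun v v' hv => hw (.inr v) (.inr v') (congrArg (Option.map Sum.inr) hv)) h)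
    exact le_of_eq (congrArg _ (funext fun v => hw (.inl v) (.inl v) rfl))
  | orR B S ih =>
    refine par_mono _ _ _ _ ?_
      (ih (fun v v' hv => hw (.inr v) (.inr v') (congrArg (Option.map Sum.inr) hv)) h)
    exact le_of_eq (congrArg _ (funext fun v => hw (.inl v) (.inl v) rfl))
  | ex y S ih =>
    exact tens_mono _ _ _ _ (le_of_eq (hw (.inl ()) (.inl ()) rfl))
      (ih (fun v v' hv => hw (.inr v) (.inr v') (congrArg (Option.map Sum.inr) hv)) h)
  | all y S ih =>
    exact par_mono _ _ _ _ (le_of_eq (hw (.inl ()) (.inl ()) rfl))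
      (ih (fun v v' hv => hw (.inr v) (.inr v') (congrArg (Option.map Sum.inr) hv)) h)

/-- This is the comparison at an existential binder above the hole: `b` and `u` are the old values
of the binder and of its range, `b'` and `u'` the new ones. A unit `0` may be raised to `1` only
because `u ≠ 0`; a new value `-1` makes the comparison hold whatever happens below. -/
theorem tens_step : ∀ b b' u u' : SignType, (b' = b ∨ (b = 0 ∧ b' = 1) ∨ b' = -1) → u ≠ 0 →
    (u' ≤ u ∨ b' = -1) → tens b' u' ≤ tens b u := by decide

/-- This is the comparison at a universal binder above the hole. Raising `-1` to the unit `0` is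
harmless because `u ≠ 0`, and a binder of value `1` absorbs whatever happens below. -/
theorem par_step : ∀ b b' u u' : SignType, (b' = b ∨ (b = -1 ∧ b' = 0)) → u ≠ 0 →
    (u' ≤ u ∨ (b = 1 ∧ b' = 1)) → par b' u' ≤ par b u := by decide

theorem val_fill_ne_zero {S : Ctx L} {w : (S.fill Q).Vtx → SignType}
    (h : (Q.val fun o => w (S.incl o)) ≠ 0) : (S.fill Q).val w ≠ 0 := by
  induction S with
  | hole => exact h
  | andL _ _ ih => exact tens_ne_zero_left _ _ (ih h)
  | orL _ _ ih => exact par_ne_zero_left _ _ (ih h)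
  | andR _ _ ih | ex _ _ ih => exact tens_ne_zero_right _ _ (ih h)
  | orR _ _ ih | all _ _ ih => exact par_ne_zero_right _ _ (ih h)

/-- Comparison of the values of a context for two valuations that may differ on the quantifiers
above the hole, provided that the formula in the hole has a value different from `0`. -/
theorem val_fill_le_of_ne_zero {S : Ctx L} {w : (S.fill Q).Vtx → SignType}
    {w' : (S.fill P).Vtx → SignType}
    (hw : ∀ v v', S.extend f v = some v' → ¬ S.Above v → w' v' = w v)
    (hall : ∀ v v', S.extend f v = some v' → S.Above v → (S.fill Q).kind v = .all →
      w' v' = w v ∨ (w v = -1 ∧ w' v' = 0))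
    (hex : ∀ v v', S.extend f v = some v' → S.Above v → (S.fill Q).kind v = .ex →
      w' v' = w v ∨ (w v = 0 ∧ w' v' = 1) ∨ w' v' = -1)
    (h0 : (Q.val fun o => w (S.incl o)) ≠ 0)
    (h : (P.val fun p => w' (S.incl p)) ≤ (Q.val fun o => w (S.incl o)) ∨
      ∃ v v', S.extend f v = some v' ∧ S.Above v ∧
        (((S.fill Q).kind v = .all ∧ w v = 1 ∧ w' v' = 1) ∨
          ((S.fill Q).kind v = .ex ∧ w' v' = -1))) :
    (S.fill P).val w' ≤ (S.fill Q).val w := by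
  induction S with
  | hole =>
    refine h.resolve_right ?_
    rintro ⟨v, v', -, hv, -⟩
    exact hv
  | andL S B ih | orL S B ih =>
    have key := ih (fun v v' hv => hw (.inl v) (.inl v') (congrArg (Option.map Sum.inl) hv))
      (fun v v' hv => hall (.inl v) (.inl v') (congrArg (Option.map Sum.inl) hv))
      (fun v v' hv => hex (.inl v) (.inl v') (congrArg (Option.map Sum.inl) hv)) h0 (by
        refine h.imp id ?_
        rintro ⟨v | v, v', hv, ha, h⟩
        · obtain ⟨u, hu, rfl⟩ := Option.map_eq_some_iff.1 hv
          exact ⟨v, u, hu, ha, h⟩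
        · exact ha.elim)
    have hB : (B.val fun v => w' (.inr v)) = B.val fun v => w (.inr v) :=
      congrArg _ (funext fun v => hw (.inr v) (.inr v) rfl id)
    first
    | exact tens_mono _ _ _ _ key hB.le
    | exact par_mono _ _ _ _ key hB.le
  | andR B S ih | orR B S ih =>
    have key := ih (fun v v' hv => hw (.inr v) (.inr v') (congrArg (Option.map Sum.inr) hv))
      (fun v v' hv => hall (.inr v) (.inr v') (congrArg (Option.map Sum.inr) hv))
      (fun v v' hv => hex (.inr v) (.inr v') (congrArg (Option.map Sum.inr) hv)) h0 (by
        refine h.imp id ?_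
        rintro ⟨v | v, v', hv, ha, h⟩
        · exact ha.elim
        · obtain ⟨u, hu, rfl⟩ := Option.map_eq_some_iff.1 hv
          exact ⟨v, u, hu, ha, h⟩)
    have hB : (B.val fun v => w' (.inl v)) = B.val fun v => w (.inl v) :=
      congrArg _ (funext fun v => hw (.inl v) (.inl v) rfl id)
    first
    | exact tens_mono _ _ _ _ hB.le key
    | exact par_mono _ _ _ _ hB.le key
  | ex y S ih =>
    have key := ih (fun v v' hv => hw (.inr v) (.inr v') (congrArg (Option.map Sum.inr) hv))
      (fun v v' hv => hall (.inr v) (.inr v') (congrArg (Option.map Sum.inr) hv))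
      (fun v v' hv => hex (.inr v) (.inr v') (congrArg (Option.map Sum.inr) hv)) h0
    refine tens_step _ _ _ _ (hex (.inl ()) (.inl ()) rfl trivial rfl) (val_fill_ne_zero h0) ?_
    rcases h with h | ⟨v | v, v', hv, ha, h⟩
    · exact Or.inl (key (Or.inl h))
    · cases hv
      exact Or.inr (h.resolve_left fun h => nomatch h.1).2
    · obtain ⟨u, hu, rfl⟩ := Option.map_eq_some_iff.1 hv
      exact Or.inl (key (Or.inr ⟨v, u, hu, ha, h⟩))
  | all y S ih =>
    have key := ih (fun v v' hv => hw (.inr v) (.inr v') (congrArg (Option.map Sum.inr) hv))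
      (fun v v' hv => hall (.inr v) (.inr v') (congrArg (Option.map Sum.inr) hv))
      (fun v v' hv => hex (.inr v) (.inr v') (congrArg (Option.map Sum.inr) hv)) h0
    refine par_step _ _ _ _ (hall (.inl ()) (.inl ()) rfl trivial rfl) (val_fill_ne_zero h0) ?_
    rcases h with h | ⟨v | v, v', hv, ha, h⟩
    · exact Or.inl (key (Or.inl h))
    · cases hv
      exact Or.inr (h.resolve_right fun h => nomatch h.1).2
    · obtain ⟨u, hu, rfl⟩ := Option.map_eq_some_iff.1 hv
      exact Or.inl (key (Or.inr ⟨v, u, hu, ha, h⟩))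

end Ctx

variable {L : FirstOrder.Language.{u, v}}

theorem Label.subst_var (l : Label L) : l.subst Term.var = l := by
  cases l with
  | atom a => exact congrArg _ a.subst_var
  | var x => rfl

/-! ### Effect of a single rule on occurrences, labels and values -/

namespace Rule

variable {P Q : Fml L}

/-- The substitution that turns the labels of the conclusion of a rule into those of its
premise. -/
def sub : {P Q : Fml L} → Rule P Q → ℕ → L.Term ℕ
  | _, _, ex x t _ _ => single x t
  | _, _, _ => Term.var

theorem kind_trace (r : Rule P Q) {o : Q.Vtx} {p : P.Vtx} (h : r.trace o = some p) :
    P.kind p = Q.kind o := by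
  cases r with
  | all x => rcases o with o | o; exacts [(nomatch h), rfl]
  | ai a => exact nomatch h
  | tt =>
    rcases o with o | o
    · cases h; rfl
    · exact nomatch h
  | sw A B C => rcases o with (o | o) | o <;> cases h <;> rfl
  | mix A B => rcases o with o | o <;> cases h <;> rfl
  | ex x t A hA =>
    rcases o with o | o
    · exact nomatch h
    · cases h; exact Fml.kind_substVtx _ A o
  | equiv e => cases h; exact e.kind_vtx o

theorem lab_trace (r : Rule P Q) (hQ : Q.Rectified) {o : Q.Vtx} {p : P.Vtx}
    (h : r.trace o = some p) : P.lab p = (Q.lab o).subst r.sub := by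
  cases r with
  | all x => rcases o with o | o; exacts [(nomatch h), rfl]
  | ai a => exact nomatch h
  | tt =>
    rcases o with o | o
    · cases h; exact (Label.subst_var _).symm
    · exact nomatch h
  | sw A B C => rcases o with (o | o) | o <;> cases h <;> exact (Label.subst_var _).symm
  | mix A B => rcases o with o | o <;> cases h <;> exact (Label.subst_var _).symm
  | ex x t A hA =>
    rcases o with o | o
    · exact nomatch h
    · cases h
      have hx := (hQ.of_cons rfl rfl).2
      exact Fml.lab_substVtx (fun y hy => single_of_ne t (by rintro rfl; exact hx hy)) o
  | equiv e => cases h; exact (e.lab_vtx o).trans (Label.subst_var _).symm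

theorem trace_injective (r : Rule P Q) (o o' : Q.Vtx) (p : P.Vtx) (h : r.trace o = some p)
    (h' : r.trace o' = some p) : o = o' := by
  cases r with
  | all x =>
    rcases o with o | o <;> rcases o' with o' | o'
    exacts [(nomatch h), (nomatch h), (nomatch h'), rfl]
  | ai a => exact nomatch h
  | tt =>
    rcases o with o | o <;> rcases o' with o' | o'
    exacts [by cases h; cases h'; rfl, (nomatch h'), (nomatch h), (nomatch h)]
  | sw A B C => exact (Equiv.sumAssoc _ _ _).injective (Option.some.inj (h.trans h'.symm))
  | mix A B => exact Option.some.inj (h.trans h'.symm)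
  | ex x t A hA =>
    rcases o with o | o <;> rcases o' with o' | o'
    · exact nomatch h
    · exact nomatch h
    · exact nomatch h'
    · exact congrArg Sum.inr ((Fml.substVtx _ A).injective (Option.some.inj (h.trans h'.symm)))
  | equiv e => exact e.vtx.injective (Option.some.inj (h.trans h'.symm))

theorem trace_surjective (r : Rule P Q) (p : P.Vtx) :
    (∃ o, r.trace o = some p) ∨ P.lab p = .atom .tt := by
  cases r with
  | all x => exact Or.inr rfl
  | ai a => exact Or.inr rfl
  | tt => exact Or.inl ⟨.inl p, rfl⟩
  | sw A B C =>
    exact Or.inl ⟨(Equiv.sumAssoc _ _ _).symm p, congrArg some (Equiv.apply_symm_apply _ p)⟩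
  | mix A B => exact Or.inl ⟨p, rfl⟩
  | ex x t A hA =>
    exact Or.inl ⟨.inr ((Fml.substVtx _ A).symm p), congrArg some (Equiv.apply_symm_apply _ p)⟩
  | equiv e => exact Or.inl ⟨e.vtx.symm p, congrArg some (Equiv.apply_symm_apply _ p)⟩

theorem fFree (r : Rule P Q) (h : Q.FFree) : P.FFree := by
  cases r with
  | all x => exact h
  | ai a => exact nofun
  | tt => exact h.1
  | sw A B C => exact ⟨h.1.1, h.1.2, h.2⟩
  | mix A B => exact h
  | ex x t A hA => exact Fml.fFree_subst.2 h
  | equiv e => exact e.fFree_iff.1 h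

/-- By `hn`, a lone new occurrence is not `-1`, so it does not lower the value; if one of the two
atoms of `ai` is `-1`, the other is `1`, so their `par` is nonnegative. The truth constants that a
rule consumes count as the unit `0`. -/
theorem val_le (r : Rule P Q) {w : Q.Vtx → SignType} {w' : P.Vtx → SignType}
    (hw : ∀ o p, r.trace o = some p → w' p = w o) (h0 : ∀ p, (∀ o, r.trace o ≠ some p) → w' p = 0)
    (hn : ∀ o, r.trace o = none → w o = -1 → ∃ o', r.trace o' = none ∧ w o' = 1) :
    P.val w' ≤ Q.val w := by
  cases r with
  | all x =>
    have h1 : w (.inl ()) ≠ -1 := fun h => by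
      obtain ⟨o | o, ho, h'⟩ := hn (.inl ()) rfl h
      · exact absurd (h.symm.trans h') (by decide)
      · exact nomatch ho
    have h2 : w' () = w (.inr ()) := hw (.inr ()) () rfl
    have : ∀ a b : SignType, a ≠ -1 → b ≤ par a b := by decide
    exact h2.trans_le (this _ _ h1)
  | ai a =>
    have h1 : w' () = 0 := h0 () nofun
    have h2 : w (.inl ()) = -1 → w (.inr ()) = 1 := fun h => by
      obtain ⟨o | o, -, h'⟩ := hn (.inl ()) rfl h
      · exact absurd (h.symm.trans h') (by decide)
      · exact h'
    have h3 : w (.inr ()) = -1 → w (.inl ()) = 1 := fun h => by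
      obtain ⟨o | o, -, h'⟩ := hn (.inr ()) rfl h
      · exact h'
      · exact absurd (h.symm.trans h') (by decide)
    have : ∀ a b : SignType, (a = -1 → b = 1) → (b = -1 → a = 1) → 0 ≤ par a b := by decide
    exact h1.trans_le (this _ _ h2 h3)
  | tt =>
    have h1 : w (.inr ()) ≠ -1 := fun h => by
      obtain ⟨o | o, ho, h'⟩ := hn (.inr ()) rfl h
      · exact nomatch ho
      · exact absurd (h.symm.trans h') (by decide)
    have h2 : w' = fun p => w (.inl p) := funext fun p => hw (.inl p) p rfl
    have : ∀ a b : SignType, b ≠ -1 → a ≤ tens a b := by decide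
    rw [h2]
    exact this _ _ h1
  | sw A B C =>
    have hA : (fun p => w' (.inl p)) = fun p => w (.inl (.inl p)) :=
      funext fun p => hw (.inl (.inl p)) _ rfl
    have hB : (fun p => w' (.inr (.inl p))) = fun p => w (.inl (.inr p)) :=
      funext fun p => hw (.inl (.inr p)) _ rfl
    have hC : (fun p => w' (.inr (.inr p))) = fun p => w (.inr p) :=
      funext fun p => hw (.inr p) _ rfl
    simp only [Fml.val, hA, hB, hC]
    exact tens_par_le _ _ _
  | mix A B =>
    obtain rfl : w' = w := funext fun p => hw p p rfl
    exact tens_le_par _ _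
  | ex x t A hA =>
    have h1 : w (.inl ()) ≠ -1 := fun h => by
      obtain ⟨o | o, ho, h'⟩ := hn (.inl ()) rfl h
      · exact absurd (h.symm.trans h') (by decide)
      · exact nomatch ho
    have h2 : (fun o => w' (A.substVtx (single x t) o)) = fun o => w (.inr o) :=
      funext fun o => hw (.inr o) _ rfl
    have : ∀ a b : SignType, a ≠ -1 → b ≤ tens a b := by decide
    rw [Fml.val_subst, h2]
    exact this _ _ h1
  | equiv e =>
    have h2 : (fun o => w' (e.vtx o)) = w := funext fun o => hw o _ rfl
    rw [← e.val_vtx, h2]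

/-- The labels of corresponding occurrences in the conclusion and the premise of a rule
instance. -/
theorem lab_extend (r : Rule P Q) {S : Ctx L} (hS : (S.fill Q).Rectified) {v : (S.fill Q).Vtx}
    {v' : (S.fill P).Vtx} (h : S.extend r.trace v = some v') :
    (S.fill P).lab v' = ((S.fill Q).lab v).subst r.sub := by
  by_cases hv : ∃ o, v = S.incl o
  · obtain ⟨o, rfl⟩ := hv
    rw [Ctx.extend_incl, Option.map_eq_some_iff] at h
    obtain ⟨p, hp, rfl⟩ := h
    rw [Ctx.lab_incl, Ctx.lab_incl, r.lab_trace (Ctx.rectified_of_fill hS) hp]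
  · rcases Ctx.extend_cases_of_eq_some h with ⟨o, p, hvo, -⟩ | ⟨hlab, -⟩
    · exact absurd ⟨o, hvo⟩ hv
    · rw [hlab]
      cases r with
      | ex x t A hA =>
        cases hl : (S.fill (.ex x A)).lab v with
        | var y => rfl
        | atom a =>
          -- Outside of the hole the bound variable `x` does not occur, so the substitution has no
          -- effect there.
          refine congrArg Label.atom (Atom.subst_single_of_notMem t fun hx => hv ?_).symm
          exact Ctx.exists_eq_incl_of_mem_vars hS List.mem_cons_self hl hx
      | all | ai | tt | sw | mix | equiv => exact (Label.subst_var _).symm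

theorem kind_extend (r : Rule P Q) {S : Ctx L} {v : (S.fill Q).Vtx}
    {v' : (S.fill P).Vtx} (h : S.extend r.trace v = some v') :
    (S.fill P).kind v' = (S.fill Q).kind v :=
  Ctx.kind_of_extend (fun _ _ => r.kind_trace) h

theorem extend_injective (r : Rule P Q) {S : Ctx L} {v w : (S.fill Q).Vtx} {u : (S.fill P).Vtx}
    (hv : S.extend r.trace v = some u) (hw : S.extend r.trace w = some u) : v = w :=
  Ctx.extend_injective r.trace_injective S v w u hv hw

theorem extend_surjective (r : Rule P Q) {S : Ctx L} {u : (S.fill P).Vtx}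
    (hu : (S.fill P).lab u ≠ .atom .tt) : ∃ v, S.extend r.trace v = some u := by
  refine (S.extend_surjective r.trace u).resolve_right ?_
  rintro ⟨p, rfl, hp⟩
  rw [Ctx.lab_incl] at hu
  exact ((r.trace_surjective p).resolve_right hu).elim hp

end Rule

/-! ### Links traced through a derivation -/

namespace Derivation

variable {B : Fml L}

theorem Rectified.conclusion {A : Fml L} {Φ : Derivation B A} (h : Φ.Rectified) : A.Rectified := by
  cases Φ with
  | nil => exact h
  | step S r Φ => exact h.1

/-- Two occurrences are linked if they originate from the same instance of the rule `ai`. -/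
def Linked {A : Fml L} (Φ : Derivation B A) (v w : A.Vtx) : Prop :=
  ∃ k, Φ.aiInstance v = some k ∧ Φ.aiInstance w = some k

section Step

variable {P Q : Fml L} {S : Ctx L} {r : Rule P Q} {Φ : Derivation B (S.fill P)}
  {v w : (S.fill Q).Vtx} {v' w' : (S.fill P).Vtx}

theorem aiInstance_step_some (h : S.extend r.trace v = some v') :
    (step S r Φ).aiInstance v = Φ.aiInstance v' := by
  simp only [aiInstance, h]

theorem aiInstance_step_none (h : S.extend r.trace v = none) :
    (step S r Φ).aiInstance v = if r.isAi then some Φ.length else none := by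
  simp only [aiInstance, h]

theorem dualizer_step : (step S r Φ).dualizer = fun z => (r.sub z).subst Φ.dualizer := by
  cases r <;> rfl

end Step

theorem aiInstance_lt {A : Fml L} {Φ : Derivation B A} {v : A.Vtx} {k : ℕ}
    (h : Φ.aiInstance v = some k) : k < Φ.length := by
  induction Φ with
  | nil => exact nomatch h
  | step S r Φ ih =>
    cases hv : S.extend r.trace v with
    | some v' =>
      rw [aiInstance_step_some hv] at h
      exact (ih h).trans (Nat.lt_succ_self _)
    | none =>
      rw [aiInstance_step_none hv] at h
      split at h
      · cases h; exact Nat.lt_succ_self _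
      · exact nomatch h

theorem kind_of_aiInstance {A : Fml L} {Φ : Derivation B A} {v : A.Vtx} {k : ℕ}
    (h : Φ.aiInstance v = some k) : A.kind v = .lit := by
  induction Φ with
  | nil => exact nomatch h
  | step S r Φ ih =>
    cases hv : S.extend r.trace v with
    | some v' =>
      rw [aiInstance_step_some hv] at h
      rw [← r.kind_extend hv, ih h]
    | none =>
      rw [aiInstance_step_none hv] at h
      obtain ⟨o, rfl, ho⟩ := Ctx.extend_eq_none hv
      rw [Ctx.kind_incl]
      cases r with
      | ai a => rcases o with o | o <;> rfl
      | all | tt | sw | mix | ex | equiv => exact nomatch h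

section Step

variable {P Q : Fml L} {S : Ctx L} {r : Rule P Q} {Φ : Derivation B (S.fill P)}
  {v w : (S.fill Q).Vtx} {v' w' : (S.fill P).Vtx}

theorem Linked.exists_extend (h : (step S r Φ).Linked v w) (hv : S.extend r.trace v = some v') :
    ∃ w', S.extend r.trace w = some w' ∧ Φ.Linked v' w' := by
  obtain ⟨k, hk, hk'⟩ := h
  rw [aiInstance_step_some hv] at hk
  cases hw : S.extend r.trace w with
  | some w' =>
    rw [aiInstance_step_some hw] at hk'
    exact ⟨w', rfl, k, hk, hk'⟩
  | none =>
    rw [aiInstance_step_none hw] at hk'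
    split at hk'
    -- A last instance of `ai` has the index `Φ.length`, which exceeds all indices in use above it.
    · cases hk'; exact absurd (aiInstance_lt hk) (lt_irrefl _)
    · exact nomatch hk'

theorem Linked.symm (h : Φ.Linked v' w') : Φ.Linked w' v' := h.imp fun _ h => h.symm

theorem Linked.extend_eq_none (h : (step S r Φ).Linked v w) (hv : S.extend r.trace v = none) :
    S.extend r.trace w = none := by
  cases hw : S.extend r.trace w with
  | none => rfl
  | some w' =>
    obtain ⟨v', hv', -⟩ := Linked.exists_extend (Linked.symm h) hw
    simp [hv] at hv'

end Step

/-! ### Dualizers -/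

/-- The substitution moves existentially bound variables only, and dualizes linked atoms. -/
def Dualizes {A : Fml L} (Φ : Derivation B A) (δ : ℕ → L.Term ℕ) : Prop :=
  (∀ x, (∀ b, A.kind b = .ex → A.lab b ≠ .var x) → δ x = Term.var x) ∧
    ∀ v w a b, Φ.Linked v w → v ≠ w → A.lab v = .atom a → A.lab w = .atom b →
      b.subst δ = (a.subst δ).dual

section Step

variable {P Q : Fml L} {S : Ctx L} {r : Rule P Q} {Φ : Derivation B (S.fill P)}

theorem exists_ex_of_premise {x : ℕ} (hS : (S.fill Q).Rectified) {b' : (S.fill P).Vtx}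
    (hb : (S.fill P).kind b' = .ex) (hx : (S.fill P).lab b' = .var x) :
    ∃ b, S.extend r.trace b = some b' ∧ (S.fill Q).kind b = .ex ∧ (S.fill Q).lab b = .var x := by
  obtain ⟨b, hb'⟩ := r.extend_surjective (u := b') (by simp [hx])
  refine ⟨b, hb', (r.kind_extend hb').symm.trans hb, ?_⟩
  have h := r.lab_extend hS hb'
  rw [hx] at h
  cases hl : (S.fill Q).lab b with
  | atom a => simp [hl, Label.subst] at h
  | var y => simp only [hl, Label.subst, Label.var.injEq] at h; rw [h]

theorem lab_of_extend_var (hS : (S.fill Q).Rectified) {b : (S.fill Q).Vtx} {b' : (S.fill P).Vtx}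
    {x : ℕ} (hb : S.extend r.trace b = some b') (hx : (S.fill Q).lab b = .var x) :
    (S.fill P).lab b' = .var x := by
  rw [r.lab_extend hS hb, hx]; rfl

/-- Agreement on the atoms of the conclusion is all that is required of `δ`. For a vacuous
existential quantifier this leaves the freedom to ignore the witness term. -/
theorem dual_of_step {δ' δ : ℕ → L.Term ℕ} (hS : (S.fill Q).Rectified) (hδ' : Φ.Dualizes δ')
    (hδ : ∀ v a, (S.fill Q).lab v = .atom a → a.subst δ = (a.subst r.sub).subst δ')
    {v w : (S.fill Q).Vtx} {a b : Atom L} (hvw : (step S r Φ).Linked v w) (hne : v ≠ w)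
    (ha : (S.fill Q).lab v = .atom a) (hb : (S.fill Q).lab w = .atom b) :
    b.subst δ = (a.subst δ).dual := by
  cases hv : S.extend r.trace v with
  | some v' =>
    obtain ⟨w', hw, hl⟩ := Linked.exists_extend hvw hv
    rw [hδ v a ha, hδ w b hb]
    refine hδ'.2 v' w' _ _ hl ?_ ?_ ?_
    · rintro rfl
      exact hne (r.extend_injective hv hw)
    · rw [r.lab_extend hS hv, ha]; rfl
    · rw [r.lab_extend hS hw, hb]; rfl
  | none =>
    have hw := Linked.extend_eq_none hvw hv
    obtain ⟨k, hk, -⟩ := hvw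
    rw [aiInstance_step_none hv] at hk
    obtain ⟨o, rfl, -⟩ := Ctx.extend_eq_none hv
    obtain ⟨p, rfl, -⟩ := Ctx.extend_eq_none hw
    rw [Ctx.lab_incl] at ha hb
    cases r with
    | ai c =>
      rcases o with o | o <;> rcases p with p | p <;> cases ha <;> cases hb
      · exact absurd rfl hne
      · exact Atom.dual_subst _ δ
      · rw [Atom.dual_subst, Atom.dual_dual]
      · exact absurd rfl hne
    | all | tt | sw | mix | ex | equiv => exact nomatch hk

theorem Dualizes.step {δ : ℕ → L.Term ℕ} (hS : (S.fill Q).Rectified) (hδ : Φ.Dualizes δ) :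
    (Derivation.step S r Φ).Dualizes fun z => (r.sub z).subst δ := by
  refine ⟨fun x hx => ?_, fun v w a b => dual_of_step hS hδ fun v a _ => (a.subst_subst _ _).symm⟩
  have h1 : δ x = Term.var x := hδ.1 x fun b' hb' hl => by
    obtain ⟨b, -, hb, hbx⟩ := exists_ex_of_premise (r := r) hS hb' hl
    exact hx b hb hbx
  have h2 : r.sub x = Term.var x := by
    cases r with
    | ex y t A hA =>
      refine single_of_ne t ?_
      rintro rfl
      exact hx _ (S.kind_incl (Q := .ex x A) (Sum.inl ())) (S.lab_incl (Q := .ex x A) (Sum.inl ()))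
    | all | ai | tt | sw | mix | equiv => rfl
  exact (congrArg (·.subst δ) h2).trans h1

end Step

theorem dualizes_dualizer {A : Fml L} {Φ : Derivation (.atom .tt) A} (hΦ : Φ.Rectified) :
    Φ.Dualizes Φ.dualizer := by
  induction Φ with
  | nil => exact ⟨fun _ _ => rfl, fun v w a b ⟨k, h, _⟩ => nomatch h⟩
  | step S r Φ ih =>
    rw [dualizer_step]
    exact (ih hΦ.2).step hΦ.1

theorem eq_tt_or_aiInstance {A : Fml L} {Φ : Derivation (.atom .tt) A} (hΦ : Φ.Rectified)
    {v : A.Vtx} {a : Atom L} (h : A.lab v = .atom a) : a = .tt ∨ ∃ k, Φ.aiInstance v = some k := by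
  induction Φ generalizing a with
  | nil => cases h; exact Or.inl rfl
  | step S r Φ ih =>
    cases hv : S.extend r.trace v with
    | some v' =>
      rw [aiInstance_step_some hv]
      refine (ih hΦ.2 (v := v') (a := a.subst r.sub) ?_).imp_left Atom.subst_eq_tt.1
      rw [r.lab_extend hΦ.1 hv, h]; rfl
    | none =>
      rw [aiInstance_step_none hv]
      obtain ⟨o, rfl, ho⟩ := Ctx.extend_eq_none hv
      rw [Ctx.lab_incl] at h
      cases r with
      | all x => rcases o with o | o; exacts [(nomatch h), (nomatch ho)]
      | ai a => exact Or.inr ⟨_, rfl⟩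
      | tt =>
        rcases o with o | o
        · exact nomatch ho
        · cases h; exact Or.inl rfl
      | ex => rcases o with o | o; exacts [(nomatch h), (nomatch ho)]
      | sw | mix | equiv => exact nomatch ho

theorem Linked.preDual {A : Fml L} {Φ : Derivation (.atom .tt) A} (hΦ : Φ.Rectified)
    (hA : A.FFree) {v w : A.Vtx} (h : Φ.Linked v w) (hne : v ≠ w) :
    ∃ a b, A.lab v = .atom a ∧ A.lab w = .atom b ∧ Atom.PreDual a b := by
  obtain ⟨k, hk, hk'⟩ := id h
  obtain ⟨a, ha⟩ := Fml.lab_of_kind_eq_lit (kind_of_aiInstance hk)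
  obtain ⟨b, hb⟩ := Fml.lab_of_kind_eq_lit (kind_of_aiInstance hk')
  exact ⟨a, b, ha, hb, Atom.preDual_of_subst ((dualizes_dualizer hΦ).2 v w a b h hne ha hb)
    (Fml.ne_ff_of_fFree hA ha) (Fml.ne_ff_of_fFree hA hb)⟩

/-- Going downwards, a literal can vanish only if it is `tt`. Without `ff` the atoms of a link have
dual predicate symbols, so both survive to the conclusion; the trace is injective, so nothing else
joins them. -/
theorem exists_link {A : Fml L} {Φ : Derivation (.atom .tt) A} (hΦ : Φ.Rectified)
    (hA : A.FFree) {v : A.Vtx} {k : ℕ} (h : Φ.aiInstance v = some k) :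
    ∃ w, v ≠ w ∧ ∀ z, Φ.aiInstance z = some k ↔ z = v ∨ z = w := by
  induction Φ with
  | nil => exact nomatch h
  | step S r Φ ih =>
    cases hv : S.extend r.trace v with
    | some v' =>
      have h' := h
      rw [aiInstance_step_some hv] at h'
      have hP := Ctx.fFree_fill r.fFree hA
      obtain ⟨w', hne, hw'⟩ := ih hΦ.2 hP h'
      obtain ⟨a, b, -, hb, hab⟩ := Linked.preDual hΦ.2 hP ⟨k, h', (hw' w').2 (.inr rfl)⟩ hne
      obtain ⟨w, hw⟩ := r.extend_surjective (u := w') (by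
        rw [hb]
        cases hab
        simp)
      refine ⟨w, ?_, fun z => ⟨fun hz => ?_, ?_⟩⟩
      · rintro rfl
        exact hne (Option.some.inj (hv.symm.trans hw))
      · obtain ⟨z', hz', -⟩ := Linked.exists_extend ⟨k, h, hz⟩ hv
        rw [aiInstance_step_some hz'] at hz
        rcases (hw' z').1 hz with rfl | rfl
        · exact Or.inl (r.extend_injective hz' hv)
        · exact Or.inr (r.extend_injective hz' hw)
      · rintro (rfl | rfl)
        · exact h
        · rw [aiInstance_step_some hw]
          exact (hw' w').2 (.inr rfl)
    | none =>
      have h' := h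
      rw [aiInstance_step_none hv] at h'
      obtain ⟨o, rfl, -⟩ := Ctx.extend_eq_none hv
      cases r with
      | ai a =>
        have key : ∀ z, (step S (Rule.ai a) Φ).aiInstance z = some k ↔
            ∃ p : (Fml.or (.atom a) (.atom a.dual)).Vtx, z = S.incl p := by
          intro z
          constructor
          · intro hz
            obtain ⟨p, rfl, -⟩ := Ctx.extend_eq_none (Linked.extend_eq_none ⟨k, h, hz⟩ hv)
            exact ⟨p, rfl⟩
          · rintro ⟨p, rfl⟩
            rw [aiInstance_step_none (Ctx.extend_incl S _)]
            exact h'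
        rcases o with o | o
        · refine ⟨S.incl (Q := .or (.atom a) (.atom a.dual)) (Sum.inr ()), ?_, fun z => ?_⟩
          · exact fun e => nomatch S.incl_injective e
          · rw [key]
            exact Sum.exists.trans (or_congr ⟨fun ⟨_, h⟩ => h, fun h => ⟨(), h⟩⟩
              ⟨fun ⟨_, h⟩ => h, fun h => ⟨(), h⟩⟩)
        · refine ⟨S.incl (Q := .or (.atom a) (.atom a.dual)) (Sum.inl ()), ?_, fun z => ?_⟩
          · exact fun e => nomatch S.incl_injective e
          · rw [key]
            exact (Sum.exists.trans (or_congr ⟨fun ⟨_, h⟩ => h, fun h => ⟨(), h⟩⟩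
              ⟨fun ⟨_, h⟩ => h, fun h => ⟨(), h⟩⟩)).trans or_comm
      | all | tt | sw | mix | ex | equiv => exact nomatch h'

end Derivation

/-! ### Valuations along a derivation -/

section Valuation

variable {V V' : Type}

/-- Every vertex with value `-1` is linked to a vertex with value `1`, or depends on a vertex with
value `1`, or a vertex with a value different from `0` depends on it. -/
def IsExplained (C E : V → V → Prop) (w : V → SignType) : Prop :=
  ∀ v, w v = -1 → (∃ u, C v u ∧ w u = 1) ∨ (∃ u, E v u ∧ w u = 1) ∨ ∃ u, E u v ∧ w u ≠ 0

open Classical in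
/-- Transport of a valuation along a partial injection, by `0` outside of its range. -/
noncomputable def transport (f : V → Option V') (w : V → SignType) (v' : V') : SignType :=
  if h : ∃ v, f v = some v' then w h.choose else 0

theorem transport_of_eq {f : V → Option V'}
    (hf : ∀ v v₁ v', f v = some v' → f v₁ = some v' → v = v₁) (w : V → SignType) {v : V} {v' : V'}
    (h : f v = some v') : transport f w v' = w v := by
  have h' : ∃ v, f v = some v' := ⟨v, h⟩
  rw [transport, dif_pos h', hf _ _ _ h'.choose_spec h]

theorem transport_of_forall_ne {f : V → Option V'} (w : V → SignType) {v' : V'}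
    (h : ∀ v, f v ≠ some v') : transport f w v' = 0 :=
  dif_neg fun ⟨v, hv⟩ => h v hv

/-- The inverse image of a relation under a partial map. -/
def InvRel (f : V → Option V') (E : V' → V' → Prop) (v w : V) : Prop :=
  ∃ v' w', f v = some v' ∧ f w = some w' ∧ E v' w'

end Valuation

namespace Derivation

variable {L : FirstOrder.Language.{u, v}} {B : Fml L}

/-- The value of the formula is nonnegative for all explained valuations. -/
def IsSound {A : Fml L} (Φ : Derivation B A) (E : A.Vtx → A.Vtx → Prop) : Prop :=
  ∀ w, IsExplained Φ.Linked E w → 0 ≤ A.val w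

section Step

variable {P Q : Fml L} {S : Ctx L}

/-- The valuation is transported to the premise, where explanations persist. A new occurrence takes
part in no pair of the inherited relation, so if it has value `-1` it must be linked to another new
occurrence of value `1`, as `Rule.val_le` demands. -/
theorem IsSound.step {r : Rule P Q} {Φ : Derivation B (S.fill P)}
    {E : (S.fill P).Vtx → (S.fill P).Vtx → Prop} (h : Φ.IsSound E) :
    (Derivation.step S r Φ).IsSound (InvRel (S.extend r.trace) E) := by
  intro w hw
  have hinj : ∀ v v₁ v', S.extend r.trace v = some v' → S.extend r.trace v₁ = some v' → v = v₁ :=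
    fun _ _ _ => r.extend_injective
  have ht {v v'} (h : S.extend r.trace v = some v') := transport_of_eq hinj w h
  refine (h (transport (S.extend r.trace) w) fun v' hv' => ?_).trans
    (Ctx.val_fill_le (fun v v' => ht) (r.val_le (fun o p hop => ?_) (fun p hp => ?_) ?_))
  · have hv : ∃ v, S.extend r.trace v = some v' := by
      by_contra hne
      rw [transport_of_forall_ne w fun v hv => hne ⟨v, hv⟩] at hv'
      exact absurd hv' (by decide)
    obtain ⟨v, hv⟩ := hv
    rw [ht hv] at hv'
    rcases hw v hv' with ⟨u, hu, hwu⟩ | ⟨u, ⟨v₁, u', hv₁, hu, hE⟩, hwu⟩ |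
      ⟨u, ⟨u', v₁, hu, hv₁, hE⟩, hwu⟩
    · obtain ⟨u', hu', hl⟩ := Linked.exists_extend hu hv
      exact Or.inl ⟨u', hl, (ht hu').trans hwu⟩
    · cases hv.symm.trans hv₁
      exact Or.inr (Or.inl ⟨u', hE, (ht hu).trans hwu⟩)
    · cases hv.symm.trans hv₁
      exact Or.inr (Or.inr ⟨u', hE, (ht hu).trans_ne hwu⟩)
  · exact ht (by rw [Ctx.extend_incl, hop]; rfl)
  · refine transport_of_forall_ne w fun v hv => ?_
    obtain ⟨o, ho⟩ := Ctx.exists_of_extend_eq_incl hv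
    exact hp o ho
  · intro o ho hwo
    have hv : S.extend r.trace (S.incl o) = none := by rw [Ctx.extend_incl, ho]; rfl
    rcases hw _ hwo with ⟨u, hu, hwu⟩ | ⟨u, ⟨v₁, u', hv₁, -⟩, -⟩ | ⟨u, ⟨u', v₁, -, hv₁, -⟩, -⟩
    · obtain ⟨o', rfl, ho'⟩ := Ctx.extend_eq_none (Linked.extend_eq_none hu hv)
      exact ⟨o', ho', hwu⟩
    · simp [hv] at hv₁
    · simp [hv] at hv₁

/-- The dependencies after an application of the existential rule: the new binder depends on the
universal binders above it, and inherits the dependencies of the existential binders above it. -/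
def ExDep (S : Ctx L) (x : ℕ) (t : L.Term ℕ) (A : Fml L) (h : A.FreeFor x t)
    (E : (S.fill (A.subst (single x t))).Vtx → (S.fill (A.subst (single x t))).Vtx → Prop)
    (v w : (S.fill (.ex x A)).Vtx) : Prop :=
  InvRel (S.extend (Rule.ex x t A h).trace) E v w ∨
    v = S.incl (Q := .ex x A) (Sum.inl ()) ∧ (S.Above w ∧ (S.fill (.ex x A)).kind w = .all ∨
      ∃ z, S.Above z ∧ InvRel (S.extend (Rule.ex x t A h).trace) E z w)

open Classical in
-- The premise lacks the new binder `b`, which may have explained other vertices, or be `-1` and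
-- have lowered the value at the hole. The remedy is to change the values of the binders above the
-- hole so that they take over both roles of `b`, without spoiling the comparison of the two values.
theorem IsSound.step_ex {x : ℕ} {t : L.Term ℕ} {A : Fml L} {h : A.FreeFor x t}
    {Φ : Derivation B (S.fill (A.subst (single x t)))}
    {E : (S.fill (A.subst (single x t))).Vtx → (S.fill (A.subst (single x t))).Vtx → Prop}
    (hE : ∀ b c, E b c → (S.fill (A.subst (single x t))).kind b = .ex ∧
      (S.fill (A.subst (single x t))).kind c = .all) (hs : Φ.IsSound E) :
    (Derivation.step S (Rule.ex x t A h) Φ).IsSound (ExDep S x t A h E) := by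
  intro w hw
  set r := Rule.ex x t A h with hr
  set f := S.extend r.trace with hf
  set b : (S.fill (.ex x A)).Vtx := S.incl (Q := .ex x A) (Sum.inl ()) with hb
  have hfb : f b = none := S.extend_incl (f := r.trace) (Sum.inl ())
  have hbne {v v'} (hv : f v = some v') : v ≠ b := by
    rintro rfl
    simp [hfb] at hv
  have hkE {v u} (h : InvRel f E v u) :
      (S.fill (.ex x A)).kind v = .ex ∧ (S.fill (.ex x A)).kind u = .all := by
    obtain ⟨v', u', hv, hu, h⟩ := h
    rw [← r.kind_extend hv, ← r.kind_extend hu]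
    exact hE _ _ h
  -- With value `0`, `b` neither needs an explanation nor provides one, so the generic step applies.
  by_cases hwb : w b = 0
  · refine hs.step (r := r) w fun v hv => ?_
    rcases hw v hv with h | ⟨u, h | ⟨rfl, -⟩, hwu⟩ | ⟨u, h | ⟨rfl, -⟩, hwu⟩
    · exact Or.inl h
    · exact Or.inr (Or.inl ⟨u, h, hwu⟩)
    · rw [hwb] at hv; exact absurd hv (by decide)
    · exact Or.inr (Or.inr ⟨u, h, hwu⟩)
    · exact absurd hwb hwu
  -- A universal binder above the hole with value `-1` may have been explained by `b` alone; at `0`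
  -- it needs no explanation. The existential binders above become nonzero, so that they replace `b`
  -- in explaining the universal binders that `b` inherited from them. If `b` is `-1`, those that
  -- depend on a vertex of value `1` become `-1`: they pull the context down in place of `b`, and
  -- that vertex explains them.
  let g : (S.fill (.ex x A)).Vtx → SignType := fun v =>
    if S.Above v then
      if (S.fill (.ex x A)).kind v = .all then if w v = -1 then 0 else w v
      else if w b = -1 ∧ ∃ u, InvRel f E v u ∧ w u = 1 then -1
      else if w v = 0 then 1 else w v
    else w v
  have g_not {v} (h : ¬ S.Above v) : g v = w v := if_neg h
  have g_all {v} (h : S.Above v) (hk : (S.fill (.ex x A)).kind v = .all) :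
      g v = if w v = -1 then 0 else w v := by simp only [g, if_pos h, if_pos hk]
  have g_ex {v} (h : S.Above v) (hk : (S.fill (.ex x A)).kind v = .ex) :
      g v = if w b = -1 ∧ ∃ u, InvRel f E v u ∧ w u = 1 then -1
        else if w v = 0 then 1 else w v := by simp [g, h, hk]
  have g_one {v} (hk : (S.fill (.ex x A)).kind v ≠ .ex) (h : w v = 1) : g v = 1 := by
    by_cases ha : S.Above v
    · have : (S.fill (.ex x A)).kind v = .all := by
        cases hk' : (S.fill (.ex x A)).kind v with
        | lit => exact absurd hk' ha.kind_ne_lit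
        | ex => exact absurd hk' hk
        | all => rfl
      rw [g_all ha this, h]
      decide
    · rw [g_not ha, h]
  have g_ne {v} (hk : (S.fill (.ex x A)).kind v = .ex) (h : w v ≠ 0 ∨ S.Above v) : g v ≠ 0 := by
    by_cases ha : S.Above v
    · rw [g_ex ha hk]
      split_ifs with h1 h2
      · decide
      · decide
      · exact h2
    · rw [g_not ha]
      exact h.resolve_right ha
  have hinj : ∀ v v₁ v', f v = some v' → f v₁ = some v' → v = v₁ :=
    fun _ _ _ => r.extend_injective
  have ht {v v'} (h : f v = some v') : transport f g v' = g v := transport_of_eq hinj g h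
  refine (hs (transport f g) fun v' hv' => ?_).trans
    (Ctx.val_fill_le_of_ne_zero (f := r.trace) (fun v v' hv ha => (ht hv).trans (g_not ha))
      (fun v v' hv ha hk => ?_) (fun v v' hv ha hk => ?_) ?_ ?_)
  · have hv : ∃ v, f v = some v' := by
      by_contra hne
      rw [transport_of_forall_ne g fun v hv => hne ⟨v, hv⟩] at hv'
      exact absurd hv' (by decide)
    obtain ⟨v, hv⟩ := hv
    rw [ht hv] at hv'
    -- This explanation remains valid whatever value `g` has given to `v`.
    by_cases hnew : ∃ u, InvRel f E v u ∧ w u = 1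
    · obtain ⟨u, ⟨v₁, u', hv₁, hu, hEu⟩, hwu⟩ := hnew
      have hk := (hkE ⟨v₁, u', hv₁, hu, hEu⟩).2
      cases hv.symm.trans hv₁
      exact Or.inr (Or.inl ⟨u', hEu, (ht hu).trans (g_one (by simp [hk]) hwu)⟩)
    have hwv : w v = -1 ∧ ¬ (S.Above v ∧ (S.fill (.ex x A)).kind v = .all) := by
      by_cases ha : S.Above v
      · by_cases hk : (S.fill (.ex x A)).kind v = .all
        · rw [g_all ha hk] at hv'
          split_ifs at hv' with h1
          exact absurd hv' h1
        · have hk' : (S.fill (.ex x A)).kind v = .ex := by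
            cases hk' : (S.fill (.ex x A)).kind v with
            | lit => exact absurd hk' ha.kind_ne_lit
            | ex => rfl
            | all => exact absurd hk' hk
          rw [g_ex ha hk', if_neg fun h => hnew h.2] at hv'
          split_ifs at hv' with h1
          exact ⟨hv', fun h => hk h.2⟩
      · rw [g_not ha] at hv'
        exact ⟨hv', fun h => ha h.1⟩
    rcases hw v hwv.1 with ⟨u, hu, hwu⟩ | ⟨u, hu | ⟨rfl, -⟩, hwu⟩ | ⟨u, hu | ⟨rfl, hu⟩, hwu⟩
    · obtain ⟨u', hu', hl⟩ := Linked.exists_extend hu hv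
      have hk := kind_of_aiInstance hu.choose_spec.2
      exact Or.inl ⟨u', hl, (ht hu').trans (g_one (by simp [hk]) hwu)⟩
    · exact absurd ⟨u, hu, hwu⟩ hnew
    · exact absurd rfl (hbne hv)
    · have hk := (hkE hu).1
      obtain ⟨u', v₁, hu', hv₁, hEu⟩ := hu
      cases hv.symm.trans hv₁
      exact Or.inr (Or.inr ⟨u', hEu, (ht hu').trans_ne (g_ne hk (Or.inl hwu))⟩)
    -- Here `v` was explained by `b`. The universal binders above the hole are no longer `-1`;
    -- otherwise the dependency came from some `z` above, now known only to be nonzero. This is why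
    -- the last clause of `IsExplained` asks for no more than that.
    · rcases hu with hu | ⟨z, haz, hz⟩
      · exact absurd hu hwv.2
      · have hk := (hkE hz).1
        obtain ⟨z', v₁, hz', hv₁, hEz⟩ := hz
        cases hv.symm.trans hv₁
        exact Or.inr (Or.inr ⟨z', hEz, (ht hz').trans_ne (g_ne hk (Or.inr haz))⟩)
  · rw [ht hv, g_all ha hk]
    split_ifs with h1
    exacts [Or.inr ⟨h1, rfl⟩, Or.inl rfl]
  · rw [ht hv, g_ex ha hk]
    split_ifs with h1 h2
    exacts [Or.inr (Or.inr rfl), Or.inr (Or.inl ⟨h2, rfl⟩), Or.inl rfl]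
  · exact tens_ne_zero_left _ _ hwb
  -- If `b` is `-1`, values in the hole need not compare. But `b` is explained by a universal binder
  -- of value `1` above the hole, or through an existential one there to which `g` gives `-1`;
  -- either of them absorbs the difference.
  · by_cases hwb' : w b = -1
    · right
      rcases hw b hwb' with ⟨u, hu, -⟩ | ⟨u, hu | ⟨-, hu⟩, hwu⟩ | ⟨u, hu | ⟨-, hu⟩, -⟩
      · have hk := kind_of_aiInstance hu.choose_spec.1
        exact nomatch hk.symm.trans (S.kind_incl (Q := .ex x A) (Sum.inl ()))
      · obtain ⟨_, _, hv, -⟩ := hu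
        exact absurd rfl (hbne hv)
      · rcases hu with ⟨ha, hk⟩ | ⟨z, haz, hz⟩
        · obtain ⟨u', hu'⟩ := ha.exists_extend r.trace
          exact ⟨u, u', hu', ha, Or.inl ⟨hk, hwu, (ht hu').trans (g_one (by simp [hk]) hwu)⟩⟩
        · have hk := (hkE hz).1
          obtain ⟨z', hz'⟩ := haz.exists_extend r.trace
          refine ⟨z, z', hz', haz, Or.inr ⟨hk, (ht hz').trans ?_⟩⟩
          rw [g_ex haz hk, if_pos ⟨hwb', u, hz, hwu⟩]
      · obtain ⟨_, _, -, hv, -⟩ := hu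
        exact absurd rfl (hbne hv)
      · rcases hu with ⟨ha, -⟩ | ⟨z, -, _, _, -, hv, -⟩
        · exact absurd ha (S.not_above_incl _)
        · exact absurd rfl (hbne hv)
    · left
      have h2 : (fun o => transport f g (S.incl (A.substVtx (single x t) o))) =
          fun o => w (S.incl (Q := .ex x A) (Sum.inr o)) := funext fun o => by
        rw [← g_not (S.not_above_incl (Q := .ex x A) (Sum.inr o))]
        exact ht (S.extend_incl (f := r.trace) (Sum.inr o))
      have : ∀ a b : SignType, a ≠ -1 → b ≤ tens a b := by decide
      rw [Fml.val_subst, h2]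
      exact this _ _ hwb'

end Step

end Derivation

/-! ### A relation that bounds the dependencies -/

namespace Derivation

variable {L : FirstOrder.Language.{u, v}}

/-- A relation between the existential and the universal binders that contains all dependencies and
for which explained valuations are nonnegative. -/
structure IsDepRel {A : Fml L} (Φ : Derivation (.atom .tt) A) (E : A.Vtx → A.Vtx → Prop) :
    Prop where
  kinds : ∀ b c, E b c → A.kind b = .ex ∧ A.kind c = .all
  sound : Φ.IsSound E
  dual : ∀ c y, A.kind c = .all → A.lab c = .var y → ∃ δ, Φ.Dualizes δ ∧
    ∀ b x, A.kind b = .ex → A.lab b = .var x → y ∈ (δ x).varFinset → E b c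

section Step

variable {S : Ctx L}

theorem kinds_invRel {P Q : Fml L} {r : Rule P Q} {Φ : Derivation (.atom .tt) (S.fill P)}
    {E : (S.fill P).Vtx → (S.fill P).Vtx → Prop} (hE : Φ.IsDepRel E) (b c : (S.fill Q).Vtx)
    (h : InvRel (S.extend r.trace) E b c) :
    (S.fill Q).kind b = .ex ∧ (S.fill Q).kind c = .all := by
  obtain ⟨b', c', hb, hc, h⟩ := h
  rw [← r.kind_extend hb, ← r.kind_extend hc]
  exact hE.kinds _ _ h

/-- The inherited relation has nothing depend on a new universal binder. So for its variable a
dualizer is required that does not use it at all, and this is `hnew`. -/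
theorem IsDepRel.step {P Q : Fml L} {r : Rule P Q} {Φ : Derivation (.atom .tt) (S.fill P)}
    {E : (S.fill P).Vtx → (S.fill P).Vtx → Prop} (hS : (S.fill Q).Rectified)
    (hr : r.sub = Term.var) (hex : ∀ o, r.trace o = none → Q.kind o ≠ .ex) (hE : Φ.IsDepRel E)
    (hnew : ∀ o y, r.trace o = none → Q.kind o = .all → Q.lab o = .var y →
      ∃ δ, (Derivation.step S r Φ).Dualizes δ ∧ ∀ b x, (S.fill Q).kind b = .ex →
        (S.fill Q).lab b = .var x → y ∉ (δ x).varFinset) :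
    (Derivation.step S r Φ).IsDepRel (InvRel (S.extend r.trace) E) := by
  refine ⟨kinds_invRel hE, hE.sound.step, fun c y hc hy => ?_⟩
  cases hc' : S.extend r.trace c with
  | none =>
    obtain ⟨o, rfl, ho⟩ := Ctx.extend_eq_none hc'
    rw [Ctx.kind_incl] at hc
    rw [Ctx.lab_incl] at hy
    obtain ⟨δ, hδ, h⟩ := hnew o y ho hc hy
    exact ⟨δ, hδ, fun b x hb hx hm => absurd hm (h b x hb hx)⟩
  | some c' =>
    obtain ⟨δ, hδ, h⟩ := hE.dual c' y ((r.kind_extend hc').trans hc) (lab_of_extend_var hS hc' hy)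
    refine ⟨_, hδ.step hS, fun b x hb hx hm => ?_⟩
    cases hb' : S.extend r.trace b with
    | none =>
      obtain ⟨o, rfl, ho⟩ := Ctx.extend_eq_none hb'
      rw [Ctx.kind_incl] at hb
      exact absurd hb (hex o ho)
    | some b' =>
      rw [hr] at hm
      exact ⟨b', c', hb', hc',
        h b' x ((r.kind_extend hb').trans hb) (lab_of_extend_var hS hb' hx) hm⟩

/-- Terms substituted higher up may mention `x` by accident, as a free variable. By rectification
`x` occurs in no atom of the premise, so it can be renamed in the values of the dualizer. -/
theorem exists_dualizes_of_all {x : ℕ} {Φ : Derivation (.atom .tt) (S.fill (.atom .tt))}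
    (hS : (S.fill (.all x (.atom .tt))).Rectified) (hΦ : Φ.Rectified) :
    ∃ δ, (Derivation.step S (Rule.all x) Φ).Dualizes δ ∧
      ∀ b z, (S.fill (.all x (.atom .tt))).kind b = .ex →
        (S.fill (.all x (.atom .tt))).lab b = .var z → x ∉ (δ z).varFinset := by
  have hδ := dualizes_dualizer hΦ
  -- Any variable other than `x` would do: a clash with another variable is harmless, since only
  -- occurrences of `x` are to be avoided.
  set ρ : ℕ → L.Term ℕ := single x (Term.var (x + 1)) with hρ
  -- The value at `x` is exempt from the renaming because `x` is not existential and has to stay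
  -- fixed.
  set δ : ℕ → L.Term ℕ := fun z => if z = x then Term.var x else (Φ.dualizer z).subst ρ with hδ'
  have hfresh : ∀ v a, (S.fill (.atom .tt)).lab v = .atom a → x ∉ a.vars := by
    intro v a hv hx
    rcases S.extend_surjective (Rule.all x).trace v with ⟨u, hu⟩ | ⟨p, rfl, -⟩
    · have hl := (Rule.all x).lab_extend hS hu
      rw [hv, show (Rule.all (L := L) x).sub = Term.var from rfl, Label.subst_var] at hl
      obtain ⟨o, rfl⟩ := Ctx.exists_eq_incl_of_mem_vars hS List.mem_cons_self hl.symm hx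
      rw [Ctx.lab_incl] at hl
      rcases o with o | o <;> cases hl
      exact absurd hx (Finset.notMem_empty x)
    · rw [Ctx.lab_incl] at hv
      cases hv
      exact absurd hx (Finset.notMem_empty x)
  have hsub : ∀ a : Atom L, x ∉ a.vars → a.subst δ = (a.subst Φ.dualizer).subst ρ := by
    intro a ha
    rw [Atom.subst_subst]
    exact Atom.subst_congr fun z hz => if_neg (by rintro rfl; exact ha hz)
  have hΦδ : Φ.Dualizes δ := by
    refine ⟨fun z hz => ?_, fun v w a b hvw hne ha hb => ?_⟩
    · by_cases hzx : z = x
      · simp [hδ', hzx]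
      · simp only [hδ', if_neg hzx, hδ.1 z hz]
        exact single_of_ne _ hzx
    · rw [hsub a (hfresh v a ha), hsub b (hfresh w b hb), hδ.2 v w a b hvw hne ha hb,
        Atom.dual_subst]
  refine ⟨_, hΦδ.step (r := Rule.all x) hS, fun b z hb hz hm => ?_⟩
  have hzx : z ≠ x := by
    rintro rfl
    have hc := S.lab_incl (Q := .all z (.atom .tt)) (Sum.inl ())
    have e := Fml.eq_of_lab_eq hS.1 hz hc
    have hk := S.kind_incl (Q := .all z (.atom .tt)) (Sum.inl ())
    rw [← e, hb] at hk
    exact nomatch hk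
  change x ∈ (δ z).varFinset at hm
  simp only [hδ', if_neg hzx] at hm
  obtain ⟨y, -, hy⟩ := mem_varFinset_subst.1 hm
  by_cases hyx : y = x
  · rw [hρ, hyx, single_self] at hy
    simp [Term.varFinset] at hy
  · rw [hρ, single_of_ne _ hyx] at hy
    simp [Term.varFinset] at hy
    exact hyx hy.symm

theorem eq_of_mem_varFinset {A : Fml L} {Φ : Derivation (.atom .tt) A} {δ : ℕ → L.Term ℕ}
    (hδ : Φ.Dualizes δ) {y z : ℕ} (hy : y ∈ (δ z).varFinset)
    (hz : ∀ b, A.kind b = .ex → A.lab b ≠ .var z) : y = z := by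
  rw [hδ.1 z hz] at hy
  simpa [Term.varFinset] using hy

/-- If `x` occurs in `A`, the variables of `t` occur free in the hole of the premise, so each is
free in the whole line or bound above the hole. The dependencies of the new binder therefore come
from binders above it, as `ExDep` provides. -/
theorem IsDepRel.step_ex {x : ℕ} {t : L.Term ℕ} {A : Fml L} {h : A.FreeFor x t}
    {Φ : Derivation (.atom .tt) (S.fill (A.subst (single x t)))}
    {E : (S.fill (A.subst (single x t))).Vtx → (S.fill (A.subst (single x t))).Vtx → Prop}
    (hS : (S.fill (.ex x A)).Rectified) (hΦ : Φ.Rectified) (hE : Φ.IsDepRel E) :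
    (Derivation.step S (Rule.ex x t A h) Φ).IsDepRel (ExDep S x t A h E) := by
  set r := Rule.ex x t A h with hr
  have hP := hΦ.conclusion
  have hxA : x ∉ A.boundVars := ((Ctx.rectified_of_fill hS).of_cons rfl rfl).2
  have hb0 := S.kind_incl (Q := .ex x A) (Sum.inl ())
  have hx0 := S.lab_incl (Q := .ex x A) (Sum.inl ())
  have hnone {v} (hv : S.extend r.trace v = none) : v = S.incl (Q := .ex x A) (Sum.inl ()) := by
    obtain ⟨o | o, rfl, ho⟩ := Ctx.extend_eq_none hv
    exacts [rfl, (nomatch ho)]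
  have hne {v v' z} (hv : S.extend r.trace v = some v') (hz : (S.fill (.ex x A)).lab v = .var z) :
      z ≠ x := by
    rintro rfl
    rw [Fml.eq_of_lab_eq hS.1 hz hx0] at hv
    exact nomatch (S.extend_incl (f := r.trace) (Sum.inl ())).symm.trans hv
  refine ⟨?_, hE.sound.step_ex hE.kinds, fun c y hc hy => ?_⟩
  · rintro b c (hbc | ⟨rfl, ⟨-, hc⟩ | ⟨z, -, hz⟩⟩)
    · exact kinds_invRel hE b c hbc
    · exact ⟨hb0, hc⟩
    · exact ⟨hb0, (kinds_invRel hE z c hz).2⟩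
  obtain ⟨c', hc'⟩ : ∃ c', S.extend r.trace c = some c' := by
    cases hc' : S.extend r.trace c with
    | some c' => exact ⟨c', rfl⟩
    | none =>
      rw [hnone hc'] at hc
      exact nomatch hb0.symm.trans hc
  have hck := (r.kind_extend hc').trans hc
  have hcy := lab_of_extend_var hS hc' hy
  obtain ⟨δ, hδ, hdep⟩ := hE.dual c' y hck hcy
  by_cases hxf : x ∈ A.freeVars
  · refine ⟨_, hδ.step (r := r) hS, fun b z hb hz hm => ?_⟩
    cases hb' : S.extend r.trace b with
    | some b' =>
      have hm' : y ∈ (δ z).varFinset := by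
        rwa [hr, Rule.sub, single_of_ne t (hne hb' hz)] at hm
      exact Or.inl ⟨b', c', hb', hc',
        hdep b' z ((r.kind_extend hb').trans hb) (lab_of_extend_var hS hb' hz) hm'⟩
    | none =>
      obtain rfl := hnone hb'
      cases hz.symm.trans hx0
      rw [hr, Rule.sub, single_self, mem_varFinset_subst] at hm
      obtain ⟨q, hq, hyq⟩ := hm
      refine Or.inr ⟨rfl, ?_⟩
      -- A variable `q` of `t` whose value contains `y` is not free in the line, since it would be
      -- fixed and equal to the bound variable `y`. If it is bound by an existential binder above,
      -- its dependency is inherited; if by a universal one, it is fixed, so that binder is `c`.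
      rcases S.mem_freeVars_fill (Fml.subset_freeVars_subst h hxf hxA hq) with hqf | ⟨u', hau, hu'⟩
      · have hqb : q ∉ (S.fill (A.subst (single x t))).boundVars := fun hqb => hP.2 q hqb hqf
        obtain rfl := eq_of_mem_varFinset hδ hyq
          fun b _ hbq => hqb (Fml.mem_boundVars_of_lab hbq)
        exact absurd (Fml.mem_boundVars_of_lab hcy) hqb
      · obtain ⟨u, hu⟩ := r.extend_surjective (u := u') (by simp [hu'])
        have hau' := (Ctx.above_iff_of_extend hu).1 hau
        cases hk : (S.fill (A.subst (single x t))).kind u' with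
        | lit => exact absurd hk hau.kind_ne_lit
        | ex => exact Or.inr ⟨u, hau', u', c', hu, hc', hdep u' q hk hu' hyq⟩
        | all =>
          obtain rfl := eq_of_mem_varFinset hδ hyq fun b hb hbq => by
            rw [Fml.eq_of_lab_eq hP.1 hbq hu', hk] at hb
            exact nomatch hb
          obtain rfl := Fml.eq_of_lab_eq hP.1 hu' hcy
          obtain rfl := r.extend_injective hu hc'
          exact Or.inl ⟨hau', hc⟩
  -- For a vacuous quantifier the variables of `t` may be bound anywhere, so the witness is
  -- discarded and `x` is kept fixed; no atom contains `x`.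
  · refine ⟨Function.update δ x (Term.var x), ⟨fun z hz => ?_, fun v w a b =>
      dual_of_step hS hδ fun v a hv => ?_⟩, fun b z hb hz hm => ?_⟩
    · by_cases hzx : z = x
      · rw [hzx, Function.update_self]
      · rw [Function.update_of_ne hzx]
        refine hδ.1 z fun b' hb' hl => ?_
        obtain ⟨b, -, hb, hbz⟩ := exists_ex_of_premise (r := r) hS hb' hl
        exact hz b hb hbz
    · have hxa : x ∉ a.vars := by
        intro hxa
        obtain ⟨o, rfl⟩ := Ctx.exists_eq_incl_of_mem_vars hS List.mem_cons_self hv hxa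
        rw [Ctx.lab_incl] at hv
        rcases o with o | o
        · exact nomatch hv
        · exact (Fml.mem_vars_of_lab (A := A) hv hxa).elim hxf hxA
      rw [hr, Rule.sub, Atom.subst_single_of_notMem t hxa]
      exact Atom.subst_congr fun z hz => Function.update_of_ne (by rintro rfl; exact hxa hz) _ _
    · cases hb' : S.extend r.trace b with
      | some b' =>
        rw [Function.update_of_ne (hne hb' hz)] at hm
        exact Or.inl ⟨b', c', hb', hc',
          hdep b' z ((r.kind_extend hb').trans hb) (lab_of_extend_var hS hb' hz) hm⟩
      | none =>
        obtain rfl := hnone hb'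
        cases hz.symm.trans hx0
        rw [Function.update_self] at hm
        simp only [Term.varFinset, Finset.mem_singleton] at hm
        exact absurd hm (hne hc' hy)

end Step

theorem exists_isDepRel {A : Fml L} {Φ : Derivation (.atom .tt) A} (hΦ : Φ.Rectified) :
    ∃ E, Φ.IsDepRel E := by
  induction Φ with
  | nil =>
    refine ⟨fun _ _ => False, fun _ _ => False.elim, fun w hw => ?_, fun c _ hc => nomatch hc⟩
    have h : w () ≠ -1 := fun h => by
      rcases hw () h with ⟨u, ⟨k, hk, -⟩, -⟩ | ⟨u, hu, -⟩ | ⟨u, hu, -⟩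
      exacts [(nomatch hk), hu, hu]
    have : ∀ a : SignType, a ≠ -1 → 0 ≤ a := by decide
    exact this _ h
  | step S r Φ ih =>
    obtain ⟨E, hE⟩ := ih hΦ.2
    cases r with
    | all x =>
      refine ⟨_, hE.step hΦ.1 rfl ?_ ?_⟩
      · rintro (o | o) ho hk
        exacts [(nomatch hk), (nomatch ho)]
      · rintro (o | o) y ho hk hy
        · cases hy; exact exists_dualizes_of_all hΦ.1 hΦ.2
        · exact nomatch ho
    | ai a =>
      refine ⟨_, hE.step hΦ.1 rfl ?_ ?_⟩
      · rintro (o | o) - hk <;> exact nomatch hk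
      · rintro (o | o) y - hk <;> exact nomatch hk
    | tt =>
      refine ⟨_, hE.step hΦ.1 rfl ?_ ?_⟩
      · rintro (o | o) ho hk
        exacts [(nomatch ho), (nomatch hk)]
      · rintro (o | o) y ho hk
        exacts [(nomatch ho), (nomatch hk)]
    | sw | mix | equiv => exact ⟨_, hE.step hΦ.1 rfl nofun nofun⟩
    | ex x t A h => exact ⟨_, hE.step_ex hΦ.1 hΦ.2⟩

/-! ### The linked graph of a derivation is a fonet -/

theorem isDualizer_iff {A : Fml L} {Φ : Derivation (.atom .tt) A} {δ : ℕ → L.Term ℕ} :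
    Φ.linkedGraph.IsDualizer δ ↔ Φ.Dualizes δ := by
  have h1 (x : ℕ) : (¬ ∃ b, Φ.linkedGraph.IsExistential b ∧ Φ.linkedGraph.label b = .var x) ↔
      ∀ b, A.kind b = .ex → A.lab b ≠ .var x := by
    simp only [linkedGraph, Fml.isExistential_iff, Fml.toGraph_label, not_exists, not_and, ne_eq]
  simp only [ColouredGraph.IsDualizer, Dualizes, h1]
  simp only [linkedGraph, Fml.toGraph_label]
  rfl

theorem isLinkedFograph_linkedGraph {A : Fml L} {Φ : Derivation (.atom .tt) A}
    (hΦ : Φ.Rectified) (hA : A.FFree) : Φ.linkedGraph.IsLinkedFograph := by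
  refine ⟨Fml.isFograph_toGraph hΦ.conclusion, fun v hv => ?_, fun v a ha => ?_⟩
  · obtain ⟨k, hk, -⟩ := hv
    obtain ⟨w, hne, hw⟩ := exists_link hΦ hA hk
    obtain ⟨a, b, ha, hb, hab⟩ := Linked.preDual hΦ hA ⟨k, hk, (hw w).2 (.inr rfl)⟩ hne
    refine ⟨w, a, b, hne, ?_, (A.toGraph_label v).trans ha, (A.toGraph_label w).trans hb, hab⟩
    ext z
    refine Iff.trans ⟨?_, fun hz => ⟨k, hk, hz⟩⟩ (hw z)
    rintro ⟨l, hl, hz⟩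
    rwa [Option.some.inj (hk.symm.trans hl)]
  · exact (eq_tt_or_aiInstance hΦ ((A.toGraph_label v).symm.trans ha)).imp_right
      fun ⟨k, hk⟩ => ⟨k, hk, hk⟩

/-- The dualizer `δ'` chosen for `y` is the most general one followed by some `ρ`. Both dualizers
fix the universal variable `y`, hence so does `ρ`, and `y` survives from the value of `δ` at `x` in
that of `δ'`. -/
theorem IsDepRel.of_isDependency {A : Fml L} {Φ : Derivation (.atom .tt) A} (hΦ : Φ.Rectified)
    {E : A.Vtx → A.Vtx → Prop} (hE : Φ.IsDepRel E) {b c : A.Vtx}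
    (h : Φ.linkedGraph.IsDependency b c) : E b c := by
  obtain ⟨hb, hc, x, y, δ, hx, hy, ⟨hδ, hmg⟩, hm⟩ := h
  replace hb := Fml.isExistential_iff.1 hb
  replace hc := Fml.kind_of_isUniversal hc
  replace hx := (A.toGraph_label b).symm.trans hx
  replace hy := (A.toGraph_label c).symm.trans hy
  obtain ⟨δ', hδ', hdep⟩ := hE.dual c y hc hy
  obtain ⟨ρ, hρ⟩ := hmg δ' (isDualizer_iff.2 hδ')
  have hyfix : ∀ a, A.kind a = .ex → A.lab a ≠ .var y := fun a ha hay => by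
    rw [Fml.eq_of_lab_eq hΦ.conclusion.1 hay hy, hc] at ha
    exact nomatch ha
  have hρy := hρ y
  rw [hδ'.1 y hyfix, (isDualizer_iff.1 hδ).1 y hyfix] at hρy
  refine hdep b x hb hx ?_
  rw [hρ, mem_varFinset_subst]
  refine ⟨y, hm, ?_⟩
  change Term.var y = ρ y at hρy
  rw [← hρy]
  exact Finset.mem_singleton_self y

end Derivation

/-- An induced matching determines a fixed point free involution. -/
theorem InducesMatching.exists_involution {V : Type} {G : SimpleGraph V} {W : Set V}
    (h : InducesMatching G W) : ∃ f : W → W, (∀ x, f (f x) = x) ∧ (∀ x, f x ≠ x) ∧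
      ∀ x y : W, G.Adj x y ↔ y = f x := by
  choose! f hf using h.2
  have hadj (w : V) (hw : w ∈ W) (u : V) : G.Adj w u ∧ u ∈ W ↔ u = f w := by
    have := Set.ext_iff.1 (hf w hw) u
    simpa using this
  have hmem (w : V) (hw : w ∈ W) : G.Adj w (f w) ∧ f w ∈ W := (hadj w hw _).2 rfl
  have hW (x y : W) : G.Adj x y ↔ y = (⟨f x, (hmem x x.2).2⟩ : W) := by
    rw [Subtype.ext_iff, ← hadj x x.2]
    exact ⟨fun h => ⟨h, y.2⟩, fun h => h.1⟩
  refine ⟨fun x => ⟨f x, (hmem x x.2).2⟩, fun x => ?_, fun x hx => ?_, hW⟩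
  · exact ((hW _ x).1 ((hW x _).2 rfl).symm).symm
  · exact G.irrefl ((hW x x).2 hx.symm)

namespace Derivation

variable {L : FirstOrder.Language.{u, v}}

open Classical in
theorem not_inducesBimatching {A : Fml L} {Φ : Derivation (.atom .tt) A} (hΦ : Φ.Rectified)
    (W : Set A.Vtx) : ¬ Φ.linkedGraph.InducesBimatching W := by
  rintro ⟨hG, hL⟩
  obtain ⟨E, hE⟩ := exists_isDepRel hΦ
  obtain ⟨f, hf, hf', hfG⟩ := hG.exists_involution
  obtain ⟨g, hg, hg', hgL⟩ := hL.exists_involution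
  obtain ⟨c, hc⟩ := exists_alternating_colouring f g hf hg hf' hg'
  let w : A.Vtx → SignType := fun v => if h : v ∈ W then if c ⟨v, h⟩ then 1 else -1 else 0
  have hw (x : W) : w x = if c x then 1 else -1 := dif_pos x.2
  have hwW {v} (h : w v ≠ 0) : v ∈ W := by
    by_contra hv
    exact h (dif_neg hv)
  have hw1 {x : W} : w x = 1 ↔ c x := by
    rw [hw]; split_ifs with h <;> simp [h]
  have hwn {x : W} : w x = -1 ↔ ¬ c x := by
    rw [hw]; split_ifs with h <;> simp [h]
  -- Graph edges inside `W` are exactly the pairs of `f`, along which the sign alternates.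
  have hneg : A.val w = -1 := by
    refine A.isNegative_val w ⟨fun v x y hv hx hy hvx hvy => ?_, fun v hv => ?_⟩ ?_
    · have h1 := (hfG ⟨v, hwW hv⟩ ⟨x, hwW hx⟩).1 hvx
      have h2 := (hfG ⟨v, hwW hv⟩ ⟨y, hwW hy⟩).1 hvy
      exact congrArg Subtype.val (h1.trans h2.symm)
    · have hvW := hwW (v := v) (by simp [hv])
      refine ⟨f ⟨v, hvW⟩, hwn.2 ?_, (hfG ⟨v, hvW⟩ _).2 rfl⟩
      rw [(hc _).1, not_not]
      exact hw1.1 hv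
    · obtain ⟨v, hv⟩ := hG.1
      refine ⟨v, ?_⟩
      rw [hw ⟨v, hv⟩]
      split_ifs <;> decide
  have hpos : 0 ≤ A.val w := by
    -- The leap partner of a vertex of value `-1` has value `1`; whether it is a link or a
    -- dependency in either direction decides the clause of `IsExplained`.
    refine hE.sound w fun v hv => ?_
    have hvW := hwW (v := v) (by simp [hv])
    have h1 : w (g ⟨v, hvW⟩) = 1 := by
      rw [hw1, (hc _).2]
      exact hwn.1 hv
    obtain ⟨-, (hl | hd) | (hl | hd)⟩ := (SimpleGraph.fromRel_adj _ _ _).1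
      ((hgL ⟨v, hvW⟩ (g ⟨v, hvW⟩)).2 rfl)
    · exact Or.inl ⟨_, hl, h1⟩
    · exact Or.inr (Or.inl ⟨_, hE.of_isDependency hΦ hd, h1⟩)
    · exact Or.inl ⟨_, Φ.linkedGraph.symm _ _ hl, h1⟩
    · exact Or.inr (Or.inr ⟨_, hE.of_isDependency hΦ hd, by rw [h1]; decide⟩)
  rw [hneg] at hpos
  exact absurd hpos (by decide)

end Derivation

end FOCP

theorem mainTheorem8 (L : FirstOrder.Language.{u, v}) (A : FOCP.Fml L)
    (Φ : FOCP.Derivation (FOCP.Fml.atom FOCP.Atom.tt) A)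
    (hΦ : Φ.Rectified) (hA : A.FFree) :
    Φ.linkedGraph.IsFonet ∧ Φ.linkedGraph.IsDualizer Φ.dualizer := by
  have hδ := FOCP.Derivation.isDualizer_iff.2 (FOCP.Derivation.dualizes_dualizer hΦ)
  exact ⟨⟨FOCP.Derivation.isLinkedFograph_linkedGraph hΦ hA, ⟨_, hδ⟩,
    fun ⟨W, hW⟩ => FOCP.Derivation.not_inducesBimatching hΦ W hW⟩, hδ⟩
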